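/- Let $n\ge 1$ and $m\ge n+1$ be integers, and let $\frac12\le\gamma\le\frac{n+1}{n+2}$ and $\theta=\frac{n+1}{n}-\frac{2\gamma}{n}$. Let $\mathbb B^m$ be the closed unit ball of $\mathbb R^m$ and $\mathbb S^{m-1}$ its boundary. Let $\mathbb H^n$ be the Heisenberg group, i.e. $\mathbb R^{2n+1}$ with coordinates $(x,y,t)\in\mathbb R^n\times\mathbb R^n\times\mathbb R$ and group law $$(x,y,t)*(x',y',t')=\Big(x+x',\,y+y',\,t+t'+2\sum_{j=1}^n(y_jx_j'-x_jy_j')\Big),$$ equipped with the Korányi metric $d_K(p,q)=\|q^{-1}*p\|_K$, where $\|(x,y,t)\|_K=(|(x,y)|^4+t^2)^{1/4}$. For a metric space $(X,d)$ and $\alpha>0$, let $C^{0,\alpha}(\mathbb B^m,X)$ be the class of $\alpha$-Hölder continuous maps $\mathbb B^m\to X$, and write $f\in C^{0,\alpha+}(\mathbb B^m,X)$ if $$\lim_{t\to0^+}\ \sup\Big\{\frac{d(f(x),f(y))}{|x-y|^\alpha}:\ x,y\in\mathbb B^m,\ 0<|x-y|\le t\Big\}=0.$$ Then there is no map $f$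 on $\mathbb B^m$ with values in $\mathbb H^n=\mathbb R^{2n+1}$ such that $f|_{\mathbb S^{m-1}}$ is a topological embedding and $$f\in C^{0,\gamma+}(\mathbb B^m,\mathbb H^n)\cap C^{0,\theta}(\mathbb B^m,\mathbb R^{2n+1})\quad\text{or}\quad f\in C^{0,\gamma}(\mathbb B^m,\mathbb H^n)\cap C^{0,\theta+}(\mathbb B^m,\mathbb R^{2n+1}),$$ where $\mathbb R^{2n+1}$ carries the Euclidean metric. -/

import Mathlib

open scoped NNReal ENNReal

/-- The Heisenberg group `ℍⁿ`: points `(x, y, t)` of `ℝⁿ × ℝⁿ × ℝ = ℝ²ⁿ⁺¹`. It carries the group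
law and the Korányi metric defined below (and not the Euclidean metric). -/
@[ext]
structure Heisenberg (n : ℕ) where
  /-- The coordinates `x₁, …, xₙ`. -/
  x : Fin n → ℝ
  /-- The coordinates `y₁, …, yₙ`. -/
  y : Fin n → ℝ
  /-- The vertical coordinate `t`. -/
  t : ℝ

namespace Heisenberg

variable {n : ℕ}

/-- The identity map `ℍⁿ → ℝ²ⁿ⁺¹`, where `ℝ²ⁿ⁺¹` carries the Euclidean norm. -/
noncomputable def toEuclidean (p : Heisenberg n) : EuclideanSpace ℝ (Fin n ⊕ Fin n ⊕ Unit) :=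
  WithLp.toLp 2 (Sum.elim p.x (Sum.elim p.y fun _ => p.t))

/-- The Heisenberg group law. -/
noncomputable instance : Mul (Heisenberg n) :=
  ⟨fun p q => ⟨p.x + q.x, p.y + q.y, p.t + q.t + 2 * ∑ j, (p.y j * q.x j - p.x j * q.y j)⟩⟩

noncomputable instance : One (Heisenberg n) := ⟨⟨0, 0, 0⟩⟩

noncomputable instance : Inv (Heisenberg n) := ⟨fun p => ⟨-p.x, -p.y, -p.t⟩⟩

@[simp] theorem mul_x (p q : Heisenberg n) : (p * q).x = p.x + q.x := rfl
@[simp] theorem mul_y (p q : Heisenberg n) : (p * q).y = p.y + q.y := rfl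
@[simp] theorem mul_t (p q : Heisenberg n) :
    (p * q).t = p.t + q.t + 2 * ∑ j, (p.y j * q.x j - p.x j * q.y j) := rfl
@[simp] theorem one_x : (1 : Heisenberg n).x = 0 := rfl
@[simp] theorem one_y : (1 : Heisenberg n).y = 0 := rfl
@[simp] theorem one_t : (1 : Heisenberg n).t = 0 := rfl
@[simp] theorem inv_x (p : Heisenberg n) : (p⁻¹).x = -p.x := rfl
@[simp] theorem inv_y (p : Heisenberg n) : (p⁻¹).y = -p.y := rfl
@[simp] theorem inv_t (p : Heisenberg n) : (p⁻¹).t = -p.t := rfl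

noncomputable instance : Group (Heisenberg n) :=
  Group.ofLeftAxioms
    (by
      intro a b c
      ext j
      · simp [add_assoc]
      · simp [add_assoc]
      · simp only [mul_t, mul_x, mul_y, Pi.add_apply, add_mul, mul_add, Finset.sum_sub_distrib,
          Finset.sum_add_distrib]
        ring)
    (by intro a; ext <;> simp)
    (by
      intro a
      ext j
      · simp
      · simp
      · simp [mul_comm])

/-- `|(x, y)|²`, the squared Euclidean norm of the horizontal part. -/
noncomputable def horSq (p : Heisenberg n) : ℝ := ∑ j, (p.x j ^ 2 + p.y j ^ 2)

/-- The Korányi norm `‖(x, y, t)‖_K = (|(x, y)|⁴ + t²)^(1/4)`. -/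
noncomputable def koranyiNorm (p : Heisenberg n) : ℝ := (p.horSq ^ 2 + p.t ^ 2) ^ (1 / 4 : ℝ)

theorem horSq_nonneg (p : Heisenberg n) : 0 ≤ p.horSq :=
  Finset.sum_nonneg fun _ _ => by positivity

theorem koranyiNorm_nonneg (p : Heisenberg n) : 0 ≤ p.koranyiNorm := by
  unfold koranyiNorm; positivity

theorem koranyiNorm_sq (p : Heisenberg n) :
    p.koranyiNorm ^ 2 = ‖(⟨p.horSq, p.t⟩ : ℂ)‖ := by
  have h : 0 ≤ p.horSq ^ 2 + p.t ^ 2 := by positivity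
  rw [Complex.norm_eq_sqrt_sq_add_sq, Real.sqrt_eq_rpow, koranyiNorm, ← Real.rpow_natCast,
    ← Real.rpow_mul h]
  norm_num

theorem koranyiNorm_inv (p : Heisenberg n) : (p⁻¹).koranyiNorm = p.koranyiNorm := by
  simp [koranyiNorm, horSq]

theorem koranyiNorm_one : (1 : Heisenberg n).koranyiNorm = 0 := by
  simp [koranyiNorm, horSq]

theorem eq_one_of_koranyiNorm_eq_zero {p : Heisenberg n} (h : p.koranyiNorm = 0) : p = 1 := by
  have h1 := p.koranyiNorm_sq
  rw [h, zero_pow two_ne_zero, eq_comm, norm_eq_zero, Complex.ext_iff] at h1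
  obtain ⟨hs, ht⟩ := h1
  have hs' : ∀ j, p.x j ^ 2 + p.y j ^ 2 = 0 := by
    intro j
    have hs0 : ∑ j, (p.x j ^ 2 + p.y j ^ 2) = 0 := hs
    exact (Finset.sum_eq_zero_iff_of_nonneg (fun _ _ => by positivity)).1 hs0 j (Finset.mem_univ j)
  ext j
  · simpa using (by nlinarith [hs' j, sq_nonneg (p.x j), sq_nonneg (p.y j)] : p.x j ^ 2 = 0)
  · simpa using (by nlinarith [hs' j, sq_nonneg (p.x j), sq_nonneg (p.y j)] : p.y j ^ 2 = 0)
  · exact ht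

/-- The horizontal part as a vector `x + i y` of `ℂⁿ`. -/
noncomputable def hor (p : Heisenberg n) : EuclideanSpace ℂ (Fin n) :=
  WithLp.toLp 2 fun j => ⟨p.x j, p.y j⟩

theorem norm_hor_sq (p : Heisenberg n) : ‖p.hor‖ ^ 2 = p.horSq := by
  rw [EuclideanSpace.norm_sq_eq]
  refine Finset.sum_congr rfl fun j _ => ?_
  rw [Complex.sq_norm, Complex.normSq_apply]
  simp only [hor]
  ring

theorem norm_hor_le (p : Heisenberg n) : ‖p.hor‖ ≤ p.koranyiNorm := by
  refine (pow_le_pow_iff_left₀ (norm_nonneg _) p.koranyiNorm_nonneg two_ne_zero).1 ?_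
  rw [norm_hor_sq, koranyiNorm_sq]
  exact Complex.re_le_norm ⟨p.horSq, p.t⟩

theorem koranyiNorm_mul_le (p q : Heisenberg n) :
    (p * q).koranyiNorm ≤ p.koranyiNorm + q.koranyiNorm := by
  have key : (⟨(p * q).horSq, (p * q).t⟩ : ℂ)
      = ⟨p.horSq, p.t⟩ + ⟨q.horSq, q.t⟩ + 2 * inner ℂ q.hor p.hor := by
    rw [PiLp.inner_apply]
    apply Complex.ext
    · simp only [horSq, hor, mul_x, mul_y, Pi.add_apply, Complex.add_re, Complex.mul_re,
        Complex.re_sum, Complex.re_ofNat, Complex.im_ofNat, zero_mul, sub_zero,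
        Finset.mul_sum, ← Finset.sum_add_distrib]
      refine Finset.sum_congr rfl fun j _ => ?_
      simp
      ring
    · simp only [hor, mul_t, Complex.add_im, Complex.mul_im, Complex.im_sum, Complex.re_ofNat,
        Complex.im_ofNat, zero_mul, add_zero]
      congr 2
      refine Finset.sum_congr rfl fun j _ => ?_
      simp
      ring
  refine (pow_le_pow_iff_left₀ (p * q).koranyiNorm_nonneg
    (add_nonneg p.koranyiNorm_nonneg q.koranyiNorm_nonneg) two_ne_zero).1 ?_
  rw [koranyiNorm_sq, key]
  have h1 : ‖(2 : ℂ) * inner ℂ q.hor p.hor‖ ≤ 2 * (q.koranyiNorm * p.koranyiNorm) := by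
    rw [norm_mul, Complex.norm_ofNat]
    have := norm_inner_le_norm (𝕜 := ℂ) q.hor p.hor
    have h2 := mul_le_mul q.norm_hor_le p.norm_hor_le (norm_nonneg _) q.koranyiNorm_nonneg
    linarith
  refine (norm_add₃_le).trans ?_
  rw [← koranyiNorm_sq, ← koranyiNorm_sq]
  nlinarith [h1]

/-- The metric of `ℍⁿ`: the Korányi metric `d_K(p, q) = ‖q⁻¹ * p‖_K`. -/
noncomputable instance : MetricSpace (Heisenberg n) where
  dist p q := (q⁻¹ * p).koranyiNorm
  dist_self p := by simp [koranyiNorm_one]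
  dist_comm p q := by
    rw [← koranyiNorm_inv, mul_inv_rev, inv_inv]
  dist_triangle p q r := by
    have h := koranyiNorm_mul_le (r⁻¹ * q) (q⁻¹ * p)
    rw [mul_assoc, mul_inv_cancel_left] at h
    linarith
  eq_of_dist_eq_zero := by
    intro p q h
    exact (inv_mul_eq_one.1 (eq_one_of_koranyiNorm_eq_zero h)).symm

theorem dist_def (p q : Heisenberg n) : dist p q = (q⁻¹ * p).koranyiNorm := rfl

end Heisenberg

/-- `f ∈ C^{0,α}(s, Y)`: `f` is `α`-Hölder continuous on `s`. -/
def HolderClass {X Y : Type*} [MetricSpace X] [MetricSpace Y] (α : ℝ≥0) (f : X → Y)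
    (s : Set X) : Prop :=
  ∃ C : ℝ≥0, HolderOnWith C α f s

/-- `sup {d(f x, f y) / |x - y|^α : x, y ∈ s, 0 < |x - y| ≤ t}`, possibly infinite. -/
noncomputable def holderModulus {X Y : Type*} [MetricSpace X] [MetricSpace Y] (α : ℝ≥0)
    (f : X → Y) (s : Set X) (t : ℝ) : ℝ≥0∞ :=
  ⨆ (x ∈ s) (y ∈ s) (_ : 0 < dist x y ∧ dist x y ≤ t), edist (f x) (f y) / edist x y ^ (α : ℝ)

/-- `f ∈ C^{0,α+}(s, Y)`: the above supremum tends to `0` as `t → 0⁺`. -/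
def HolderPlusClass {X Y : Type*} [MetricSpace X] [MetricSpace Y] (α : ℝ≥0) (f : X → Y)
    (s : Set X) : Prop :=
  Filter.Tendsto (holderModulus α f s) (nhdsWithin 0 (Set.Ioi 0)) (nhds 0)

/-! ### Jacobians of compactly supported maps integrate to zero. -/

section NullLagrangian

open MeasureTheory Metric Set Module

variable {V : Type*} [NormedAddCommGroup V] [NormedSpace ℝ V] [FiniteDimensional ℝ V]

/-! Restrict f to an (n+1)-dimensional ball and extend it by the radial retraction to F on ℝⁿ⁺¹.
Mollifying F at scale r gives a C¹ map u with |Du| ≤ M ~ C₂ r^(θ-1). The pullback of the contact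
form α satisfies |u*α| ≤ a ~ C₁² r^(2γ-1), because α evaluated on increments is bounded by the
square of the Korányi distance. Since 2γ + nθ = n + 1, the powers of r cancel in a·Mⁿ, and the "+"
in one of the two Hölder classes makes this product as small as desired
(`exists_smooth_approximation`).

By Stone–Weierstrass there is a C² map G from ℝ²ⁿ⁺¹ to ℝⁿ⁺¹ with G ∘ F close to the identity on the
sphere. Then G ∘ u is close to the radial projection outside the unit ball, so the integral of a
bump composed with G ∘ u against det D(G ∘ u) has a fixed positive value
(`integral_prod_mul_covDet_eq`).

The same integral is that of the pullback by u of an (n+1)-form on ℝ²ⁿ⁺¹. Modulo α the form is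
horizontal, and by symplectic linear algebra in ℝ²ⁿ every horizontal (n+1)-form is divisible by dα
(dual form: `eq_zero_of_symplectic_contraction_eq_zero`). Integration by parts moves d from α to the
coefficient, leaving O(a·Mⁿ) → 0 (`tendsto_integral_prod_mul_covDet`). The two values contradict
each other in `not_injOn_sphere`. -/

theorem bijOn_closedBall_add_of_contracting {w : V → V} {K : ℝ≥0} (hK : K < 1)
    (hw : LipschitzWith K w) {R : ℝ} (hsupp : ∀ x, R < ‖x‖ → w x = 0) :
    BijOn (fun x => x + w x) (closedBall 0 R) (closedBall 0 R) := by
  have inj : Function.Injective fun x => x + w x := by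
    intro x y hxy
    by_contra hne
    have h1 : dist (w x) (w y) ≤ K * dist x y := hw.dist_le_mul x y
    have h2 : x - y = w y - w x := by
      have : x + w x = y + w y := hxy
      rw [sub_eq_sub_iff_add_eq_add, this, add_comm]
    have h3 : dist (w x) (w y) = dist x y := by
      rw [dist_comm, dist_eq_norm, dist_eq_norm, h2]
    have h4 : 0 < dist x y := dist_pos.2 hne
    have h5 : (K : ℝ) < 1 := by exact_mod_cast hK
    nlinarith
  have surj : Function.Surjective fun x => x + w x := by
    intro y
    have hc : ContractingWith K fun x => y - w x :=
      ⟨hK, LipschitzWith.of_dist_le_mul fun a b => by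
        rw [dist_sub_left]; exact hw.dist_le_mul a b⟩
    refine ⟨hc.fixedPoint, ?_⟩
    have h := hc.fixedPoint_isFixedPt
    have h' : y - w hc.fixedPoint = hc.fixedPoint := h
    exact (sub_eq_iff_eq_add.1 h').symm
  have hout : ∀ x, R < ‖x‖ → x + w x = x := fun x hx => by rw [hsupp x hx, add_zero]
  refine ⟨fun x hx => ?_, inj.injOn, fun y hy => ?_⟩
  -- If x + w x left the ball it would be its own image, and injectivity would force it to equal x.
  · by_contra hcon
    simp only [mem_closedBall, dist_zero_right, not_le] at hcon hx
    have h := inj (hout _ hcon)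
    have h' : x + w x = x := h
    rw [h'] at hcon
    exact absurd hx (not_le.2 hcon)
  · obtain ⟨x, rfl⟩ := surj y
    refine ⟨x, ?_, rfl⟩
    by_contra hcon
    simp only [mem_closedBall, dist_zero_right, not_le] at hcon
    simp only [mem_closedBall, dist_zero_right, hout x hcon] at hy
    exact absurd hy (not_le.2 hcon)

variable [MeasurableSpace V] [BorelSpace V] (μ : Measure V) [μ.IsAddHaarMeasure]

/-- For large s, id + w/s is a bijection of the ball with positive Jacobian, so the change of
variables formula computes the integral. Only first derivatives of w are needed. -/
theorem setIntegral_det_smul_id_add_fderiv {w : V → V} (hw : ContDiff ℝ 1 w)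
    (hc : HasCompactSupport w) {R : ℝ} (hsupp : ∀ x, R < ‖x‖ → w x = 0) :
    ∃ s₁ : ℝ, 0 < s₁ ∧ ∀ s, s₁ ≤ s →
      ∫ x in closedBall 0 R, (s • ContinuousLinearMap.id ℝ V + fderiv ℝ w x).det ∂μ
        = s ^ finrank ℝ V * μ.real (closedBall 0 R) := by
  obtain ⟨L, hL⟩ := hw.lipschitzWith_of_hasCompactSupport hc one_ne_zero
  have hdet : ∀ᶠ A : V →L[ℝ] V in nhds (ContinuousLinearMap.id ℝ V), 0 < A.det := by
    refine ContinuousLinearMap.continuous_det.continuousAt.eventually (lt_mem_nhds ?_)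
    simp [ContinuousLinearMap.det]
  obtain ⟨δ, hδ, hball⟩ := Metric.eventually_nhds_iff.1 hdet
  have hL0 : (0 : ℝ) ≤ L := L.2
  -- Gives both s ≥ L + 1, making w/s a contraction, and sδ ≥ L + 1, putting id + Dw/s within δ of
  -- id.
  refine ⟨(L + 1) * (1 + 1 / δ), by positivity, fun s hs => ?_⟩
  have hs1 : (L : ℝ) + 1 ≤ s := by
    refine le_trans ?_ hs
    have : 0 ≤ 1 / δ := by positivity
    nlinarith
  have hs2 : ((L : ℝ) + 1) ≤ s * δ := by
    have h : ((L : ℝ) + 1) * (1 + 1 / δ) * δ ≤ s * δ := by gcongr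
    have h' : ((L : ℝ) + 1) * (1 + 1 / δ) * δ = (L + 1) * δ + (L + 1) := by field_simp
    have : 0 ≤ ((L : ℝ) + 1) * δ := by positivity
    linarith
  have hs0 : 0 < s := by linarith
  set φ : V → V := fun x => x + s⁻¹ • w x with hφ
  have hlip : LipschitzWith (Real.toNNReal (s⁻¹ * L)) fun x => s⁻¹ • w x := by
    refine LipschitzWith.of_dist_le_mul fun x y => ?_
    rw [dist_smul₀, Real.coe_toNNReal _ (by positivity), Real.norm_of_nonneg (by positivity),
      mul_assoc]
    gcongr
    exact hL.dist_le_mul x y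
  have hbij : BijOn φ (closedBall 0 R) (closedBall 0 R) := by
    refine bijOn_closedBall_add_of_contracting ?_ hlip fun x hx => by rw [hsupp x hx, smul_zero]
    rw [Real.toNNReal_lt_one, inv_mul_lt_iff₀ hs0]
    linarith
  have hderiv : ∀ x, HasFDerivAt φ (ContinuousLinearMap.id ℝ V + s⁻¹ • fderiv ℝ w x) x :=
    fun x => (hasFDerivAt_id x).add
      (((hw.differentiable one_ne_zero) x).hasFDerivAt.const_smul s⁻¹)
  have hpos : ∀ x, 0 < (ContinuousLinearMap.id ℝ V + s⁻¹ • fderiv ℝ w x).det := by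
    intro x
    apply hball
    rw [dist_eq_norm, add_sub_cancel_left, norm_smul, Real.norm_of_nonneg (by positivity),
      inv_mul_lt_iff₀ hs0]
    have := norm_fderiv_le_of_lipschitz ℝ hL (x₀ := x)
    linarith
  have hchange := integral_image_eq_integral_abs_det_fderiv_smul μ
    (measurableSet_closedBall (x := (0 : V)) (ε := R))
    (fun x _ => (hderiv x).hasFDerivWithinAt) hbij.injOn (fun _ => (1 : ℝ))
  rw [hbij.image_eq] at hchange
  simp only [smul_eq_mul, mul_one, abs_of_pos (hpos _), integral_const, measureReal_restrict_apply_univ] at hchange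
  rw [hchange, ← integral_const_mul]
  refine integral_congr_ae (Filter.Eventually.of_forall fun x => ?_)
  have : s • ContinuousLinearMap.id ℝ V + fderiv ℝ w x
      = s • (ContinuousLinearMap.id ℝ V + s⁻¹ • fderiv ℝ w x) := by
    rw [smul_add, smul_inv_smul₀ hs0.ne']
  simp only [this, ContinuousLinearMap.det]
  rw [ContinuousLinearMap.toLinearMap_smul, LinearMap.det_smul]

/-- Extrapolation to `0` from values at large points, for polynomials of bounded degree. -/
theorem exists_extrapolation_weights (d : ℕ) (s₁ : ℝ) :
    ∃ (t c : ℕ → ℝ), (∀ k, s₁ ≤ t k) ∧ ∀ p : Polynomial ℝ, p.natDegree ≤ d →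
      p.eval 0 = ∑ k ∈ Finset.range (d + 1), c k * p.eval (t k) := by
  have hinj : Set.InjOn (fun k : ℕ => s₁ + k) (Finset.range (d + 1)) := by
    intro a _ b _ hab
    simpa using hab
  refine ⟨fun k => s₁ + k, fun k => (Lagrange.basis (Finset.range (d + 1))
    (fun k : ℕ => s₁ + (k : ℝ)) k).eval 0, fun k => by simp, fun p hp => ?_⟩
  have h := Lagrange.eq_interpolate (f := p) hinj (by
    rw [Finset.card_range]
    exact (Polynomial.degree_le_natDegree).trans_lt (by exact_mod_cast Nat.lt_succ_of_le hp))
  conv_lhs => rw [h]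
  simp only [Lagrange.interpolate_apply, Polynomial.eval_finsetSum, Polynomial.eval_mul,
    Polynomial.eval_C]
  exact Finset.sum_congr rfl fun k _ => mul_comm _ _

/-- The Jacobian determinant of a compactly supported map has integral zero. -/
theorem integral_det_fderiv_eq_zero (hV : 0 < finrank ℝ V) {w : V → V} (hw : ContDiff ℝ 1 w)
    (hc : HasCompactSupport w) : ∫ x, (fderiv ℝ w x).det ∂μ = 0 := by
  obtain ⟨R, hR⟩ := hc.isCompact.isBounded.subset_closedBall (0 : V)
  have hsupp : ∀ x, R < ‖x‖ → w x = 0 := fun x hx => by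
    by_contra h
    have := hR (subset_tsupport w h)
    simp only [mem_closedBall, dist_zero_right] at this
    linarith
  have hout : ∀ x, x ∉ closedBall (0 : V) R → (fderiv ℝ w x).det = 0 := by
    intro x hx
    have : fderiv ℝ w x = 0 := by
      by_contra h
      exact hx (hR (support_fderiv_subset ℝ h))
    rw [this, ContinuousLinearMap.det, ContinuousLinearMap.toLinearMap_zero, LinearMap.det_zero,
      zero_pow hV.ne']
  rw [← setIntegral_eq_integral_of_forall_compl_eq_zero hout]
  obtain ⟨s₁, hs₁, hint⟩ := setIntegral_det_smul_id_add_fderiv μ hw hc hsupp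
  obtain ⟨t, c, ht, hpoly⟩ := exists_extrapolation_weights (finrank ℝ V) s₁
  -- The characteristic polynomial of -A at s is det(s + A), so det A is a fixed combination of
  -- values at large s, where the integral is known.
  have hdet : ∀ A : V →L[ℝ] V, A.det
      = ∑ k ∈ Finset.range (finrank ℝ V + 1),
          c k * (t k • ContinuousLinearMap.id ℝ V + A).det := by
    intro A
    have h := hpoly ((-A : V →L[ℝ] V) : V →ₗ[ℝ] V).charpoly (LinearMap.charpoly_natDegree _).le
    simp only [LinearMap.eval_charpoly] at h
    simpa [ContinuousLinearMap.det, Algebra.algebraMap_eq_smul_one, Module.End.one_eq_id] using h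
  have hcont : ∀ s : ℝ, Continuous fun x =>
      (s • ContinuousLinearMap.id ℝ V + fderiv ℝ w x).det := fun s =>
    ContinuousLinearMap.continuous_det.comp
      (continuous_const.add (hw.continuous_fderiv one_ne_zero))
  simp only [hdet (fderiv ℝ w _)]
  rw [integral_finsetSum _ fun k _ =>
    ((hcont (t k)).continuousOn.integrableOn_compact (isCompact_closedBall _ _)).const_mul _]
  simp only [integral_const_mul, hint _ (ht _)]
  -- The same weights extrapolate s ↦ s^dim V to its value 0 at s = 0, so the combination of the
  -- known integrals vanishes.
  have h := hpoly (Polynomial.X ^ finrank ℝ V) (by simp)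
  simp only [Polynomial.eval_pow, Polynomial.eval_X, zero_pow hV.ne'] at h
  simp only [← mul_assoc]
  rw [← Finset.sum_mul, ← h, zero_mul]

end NullLagrangian

/-! ### Determinants of differentials and their null-Lagrangian property. -/

section CovectorDeterminant

open MeasureTheory Metric Set Module

/-- The determinant of `N` covectors of `ℝᴺ`. -/
noncomputable def covDet (N : ℕ) :
    (EuclideanSpace ℝ (Fin N) →L[ℝ] ℝ) [⋀^Fin N]→ₗ[ℝ] ℝ :=
  Matrix.detRowAlternating.compLinearMap
    (LinearMap.pi fun j =>
      { toFun := fun φ => φ (EuclideanSpace.single j 1)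
        map_add' := fun _ _ => rfl
        map_smul' := fun _ _ => rfl })

theorem covDet_apply {N : ℕ} (φ : Fin N → EuclideanSpace ℝ (Fin N) →L[ℝ] ℝ) :
    covDet N φ = (Matrix.of fun i j => φ i (EuclideanSpace.single j 1)).det := rfl

theorem continuous_covDet (N : ℕ) :
    Continuous fun φ : Fin N → EuclideanSpace ℝ (Fin N) →L[ℝ] ℝ => covDet N φ := by
  simp only [covDet_apply]
  refine Continuous.matrix_det (continuous_matrix fun i j => ?_)
  exact (ContinuousLinearMap.apply ℝ ℝ (EuclideanSpace.single j (1 : ℝ))).continuous.comp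
    (continuous_apply i)

/-- `covDet` as a continuous multilinear map. -/
noncomputable def covDetCLM (N : ℕ) :
    ContinuousMultilinearMap ℝ (fun _ : Fin N => EuclideanSpace ℝ (Fin N) →L[ℝ] ℝ) ℝ :=
  ⟨(covDet N).toMultilinearMap, continuous_covDet N⟩

theorem det_eq_covDet {N : ℕ} (A : EuclideanSpace ℝ (Fin N) →L[ℝ] EuclideanSpace ℝ (Fin N)) :
    A.det = covDet N fun i => (EuclideanSpace.proj i).comp A := by
  rw [covDet_apply, ContinuousLinearMap.det,
    ← LinearMap.det_toMatrix (EuclideanSpace.basisFun (Fin N) ℝ).toBasis]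
  congr 1

variable {N : ℕ}

/-- One compactly supported component suffices: a cutoff equal to 1 near its support may multiply
all components, since off that support row i vanishes before and after. -/
theorem integral_covDet_fderiv_eq_zero {u : Fin N → EuclideanSpace ℝ (Fin N) → ℝ}
    (hu : ∀ j, ContDiff ℝ 1 (u j)) (i : Fin N) (hc : HasCompactSupport (u i)) :
    ∫ x, covDet N (fun j => fderiv ℝ (u j) x) = 0 := by
  obtain ⟨R, hR⟩ := hc.isCompact.isBounded.subset_closedBall (0 : EuclideanSpace ℝ (Fin N))
  let χ : ContDiffBump (0 : EuclideanSpace ℝ (Fin N)) :=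
    ⟨|R| + 1, |R| + 2, by positivity, by linarith⟩
  let w : EuclideanSpace ℝ (Fin N) → EuclideanSpace ℝ (Fin N) :=
    fun x => WithLp.toLp 2 fun j => χ x * u j x
  have hwj : ∀ j, ContDiff ℝ 1 fun x => χ x * u j x := fun j => χ.contDiff.mul (hu j)
  have hw : ContDiff ℝ 1 w := by
    rw [contDiff_euclidean]
    exact hwj
  have hwc : HasCompactSupport w := by
    refine HasCompactSupport.of_support_subset_isCompact χ.hasCompactSupport.isCompact
      fun x hx => subset_tsupport _ fun h => hx ?_
    ext j
    simp [w, h]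
  have h := integral_det_fderiv_eq_zero volume
    (by rw [finrank_euclideanSpace_fin]; exact i.pos) hw hwc
  rw [← h]
  refine integral_congr_ae (Filter.Eventually.of_forall fun x => ?_)
  have hproj : ∀ j, (EuclideanSpace.proj j).comp (fderiv ℝ w x)
      = fderiv ℝ (fun x => χ x * u j x) x := fun j =>
    (((EuclideanSpace.proj j : EuclideanSpace ℝ (Fin N) →L[ℝ] ℝ).hasFDerivAt.comp x
      (hw.differentiable one_ne_zero x).hasFDerivAt).fderiv).symm
  simp only [det_eq_covDet, hproj]
  by_cases hx : x ∈ closedBall 0 R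
  · congr 1
    funext j
    refine Filter.EventuallyEq.fderiv_eq ?_
    have : ball (0 : EuclideanSpace ℝ (Fin N)) (|R| + 1) ∈ nhds x := by
      refine isOpen_ball.mem_nhds ?_
      simp only [mem_ball, dist_zero_right, mem_closedBall] at hx ⊢
      linarith [le_abs_self R]
    filter_upwards [this] with y hy
    rw [χ.one_of_mem_closedBall (ball_subset_closedBall hy), one_mul]
  · have hz : u i =ᶠ[nhds x] fun _ => 0 :=
      notMem_tsupport_iff_eventuallyEq.1 fun h => hx (hR h)
    have hz' : (fun y => χ y * u i y) =ᶠ[nhds x] fun _ => 0 := by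
      filter_upwards [hz] with y hy
      rw [hy, mul_zero]
    rw [(covDet N).map_coord_zero i, (covDet N).map_coord_zero i]
    · rw [hz'.fderiv_eq, fderiv_fun_const, Pi.zero_apply]
    · rw [hz.fderiv_eq, fderiv_fun_const, Pi.zero_apply]

theorem continuous_covDet_fderiv {u : Fin N → EuclideanSpace ℝ (Fin N) → ℝ}
    (hu : ∀ j, ContDiff ℝ 1 (u j)) :
    Continuous fun x => covDet N (fun j => fderiv ℝ (u j) x) :=
  (continuous_covDet N).comp (continuous_pi fun j => (hu j).continuous_fderiv one_ne_zero)

theorem hasCompactSupport_covDet_fderiv {u : Fin N → EuclideanSpace ℝ (Fin N) → ℝ}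
    (i : Fin N) (hc : HasCompactSupport (u i)) :
    HasCompactSupport fun x => covDet N (fun j => fderiv ℝ (u j) x) :=
  (hc.fderiv ℝ).mono fun _ hx h => hx ((covDet N).map_coord_zero i h)

/-- Components are exchanged one at a time; each exchange adds a determinant with a compactly
supported component. Integrability is part of the induction because only the differences, not the
separate determinants, are known to be integrable. -/
theorem integral_covDet_fderiv_sub_eq_zero {u v : Fin N → EuclideanSpace ℝ (Fin N) → ℝ}
    (hu : ∀ j, ContDiff ℝ 1 (u j)) (hv : ∀ j, ContDiff ℝ 1 (v j))
    (hc : ∀ j, HasCompactSupport fun x => u j x - v j x) :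
    ∫ x, (covDet N (fun j => fderiv ℝ (u j) x) - covDet N (fun j => fderiv ℝ (v j) x)) = 0 := by
  classical
  suffices h : ∀ S : Finset (Fin N),
      Integrable (fun x => covDet N (fun j => fderiv ℝ (S.piecewise u v j) x)
        - covDet N (fun j => fderiv ℝ (v j) x)) ∧
      ∫ x, (covDet N (fun j => fderiv ℝ (S.piecewise u v j) x)
        - covDet N (fun j => fderiv ℝ (v j) x)) = 0 by
    simpa using (h Finset.univ).2
  intro S
  induction S using Finset.induction_on with
  | empty => simp
  | insert i S hi ih =>
    set p := S.piecewise u v with hp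
    have hpd : ∀ j, ContDiff ℝ 1 (p j) := fun j => by
      by_cases hj : j ∈ S
      · simpa [hp, hj] using hu j
      · simpa [hp, hj] using hv j
    set q := Function.update p i (fun x => u i x - v i x) with hq
    have hqd : ∀ j, ContDiff ℝ 1 (q j) := fun j => by
      by_cases hj : j = i
      · subst hj
        simpa [hq] using (hu j).sub (hv j)
      · simpa [hq, hj] using hpd j
    have hqc : HasCompactSupport (q i) := by simpa [hq] using hc i
    have hup : ∀ (g : EuclideanSpace ℝ (Fin N) → ℝ) (x : EuclideanSpace ℝ (Fin N)),
        (fun j => fderiv ℝ (Function.update p i g j) x)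
          = Function.update (fun j => fderiv ℝ (p j) x) i (fderiv ℝ g x) := by
      intro g x
      funext j
      by_cases hj : j = i
      · subst hj; simp
      · simp [hj]
    have hpi : p i = v i := by simp [hp, hi]
    have key : ∀ x, covDet N (fun j => fderiv ℝ ((insert i S).piecewise u v j) x)
        - covDet N (fun j => fderiv ℝ (v j) x)
        = covDet N (fun j => fderiv ℝ (q j) x)
          + (covDet N (fun j => fderiv ℝ (p j) x) - covDet N (fun j => fderiv ℝ (v j) x)) := by
      intro x
      rw [Finset.piecewise_insert, ← hp, hup, hq, hup]
      have : fderiv ℝ (fun x => u i x - v i x) x = fderiv ℝ (u i) x - fderiv ℝ (v i) x :=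
        fderiv_fun_sub ((hu i).differentiable one_ne_zero x)
          ((hv i).differentiable one_ne_zero x)
      rw [this, (covDet N).map_update_sub, ← hpi,
        Function.update_eq_self i (fun j => fderiv ℝ (p j) x)]
      ring
    have hqi : Integrable fun x => covDet N (fun j => fderiv ℝ (q j) x) :=
      (continuous_covDet_fderiv hqd).integrable_of_hasCompactSupport
        (hasCompactSupport_covDet_fderiv i hqc)
    simp only [key]
    exact ⟨hqi.add ih.1, by
      rw [integral_add hqi ih.1, ih.2, integral_covDet_fderiv_eq_zero hqd i hqc, add_zero]⟩

end CovectorDeterminant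

/-! ### A degree formula for maps close to the radial projection. -/

section Degree

open MeasureTheory Metric Set Module

variable {N : ℕ}

/-- The point is (c + (1 - c)‖x‖) x/‖x‖ plus an error of norm at most c/2, and the coefficient is at
least 1. Hence blending with the identity avoids the region where the bump lives. -/
theorem half_le_norm_interpolation {x y : EuclideanSpace ℝ (Fin N)} (hx : 1 ≤ ‖x‖)
    (hy : ‖y - ‖x‖⁻¹ • x‖ ≤ 1 / 2) {c : ℝ} (h0 : 0 ≤ c) (h1 : c ≤ 1) :
    1 / 2 ≤ ‖c • y + (1 - c) • x‖ := by
  have hx0 : ‖x‖ ≠ 0 := by positivity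
  have he : (1 - c) • x = ((1 - c) * ‖x‖) • (‖x‖⁻¹ • x) := by
    rw [smul_smul, mul_assoc, mul_inv_cancel₀ hx0, mul_one]
  have hdec : (c + (1 - c) * ‖x‖) • (‖x‖⁻¹ • x)
      = (c • y + (1 - c) • x) - c • (y - ‖x‖⁻¹ • x) := by
    rw [he, add_smul, smul_sub]
    abel
  have h2 : ‖(c + (1 - c) * ‖x‖) • (‖x‖⁻¹ • x)‖ = c + (1 - c) * ‖x‖ := by
    rw [norm_smul, norm_smul, norm_inv, norm_norm, inv_mul_cancel₀ hx0, mul_one,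
      Real.norm_of_nonneg]
    have : 0 ≤ (1 - c) * ‖x‖ := mul_nonneg (by linarith) (norm_nonneg _)
    linarith
  have h3 := norm_sub_le (c • y + (1 - c) • x) (c • (y - ‖x‖⁻¹ • x))
  rw [← hdec, h2, norm_smul, Real.norm_of_nonneg h0] at h3
  have h4 : c * ‖y - ‖x‖⁻¹ • x‖ ≤ 1 * (1 / 2) := by gcongr
  nlinarith

/-- With β an antiderivative of b, this turns a weighted Jacobian into an unweighted one, to which
the null-Lagrangian identities apply. -/
theorem covDet_fderiv_comp_real {β b : ℝ → ℝ} (hβ : ∀ s, HasDerivAt β (b s) s)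
    {u : Fin N → EuclideanSpace ℝ (Fin N) → ℝ} {x : EuclideanSpace ℝ (Fin N)}
    (hu : ∀ i, DifferentiableAt ℝ (u i) x) :
    covDet N (fun i => fderiv ℝ (fun x => β (u i x)) x)
      = (∏ i, b (u i x)) * covDet N (fun i => fderiv ℝ (u i) x) := by
  have h : ∀ i, fderiv ℝ (fun x => β (u i x)) x = b (u i x) • fderiv ℝ (u i) x := fun i =>
    ((hβ (u i x)).comp_hasFDerivAt x (hu i).hasFDerivAt).fderiv
  simp only [h]
  exact (covDet N).map_smul_univ _ _

/-- A map that is close to the radial projection outside the unit ball has degree one near `0`. -/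
theorem integral_prod_mul_covDet_eq {h : EuclideanSpace ℝ (Fin N) → EuclideanSpace ℝ (Fin N)}
    (hh : ContDiff ℝ 1 h) (hbd : ∀ x, 1 ≤ ‖x‖ → ‖h x - ‖x‖⁻¹ • x‖ ≤ 1 / 2)
    {b : ℝ → ℝ} (hb : Continuous b)
    (hsupp : ∀ y : EuclideanSpace ℝ (Fin N), ∏ i, b (y i) ≠ 0 → ‖y‖ < 1 / 2) :
    ∫ x, (∏ i, b (h x i)) * covDet N (fun i => fderiv ℝ (fun x => h x i) x)
      = ∫ x : EuclideanSpace ℝ (Fin N), ∏ i, b (x i) := by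
  obtain ⟨β, hβ⟩ : ∃ β : ℝ → ℝ, ∀ s, HasDerivAt β (b s) s :=
    ⟨fun s => ∫ t in (0 : ℝ)..s, b t, fun s =>
      (hb.integral_hasStrictDerivAt 0 s).hasDerivAt⟩
  have hβ1 : ContDiff ℝ 1 β := by
    rw [contDiff_one_iff_deriv]
    refine ⟨fun s => (hβ s).differentiableAt, ?_⟩
    rwa [show deriv β = b from funext fun s => (hβ s).deriv]
  let χ : ContDiffBump (0 : EuclideanSpace ℝ (Fin N)) := ⟨3 / 2, 2, by norm_num, by norm_num⟩
  -- g equals h up to radius 3/2 and the identity beyond radius 2. Replacing h by g leaves the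
  -- integrand unchanged, since both weights vanish for ‖x‖ ≥ 1.
  set g : EuclideanSpace ℝ (Fin N) → EuclideanSpace ℝ (Fin N) :=
    fun x => χ x • h x + (1 - χ x) • x with hg
  have hg1 : ContDiff ℝ 1 g :=
    (χ.contDiff.smul hh).add ((contDiff_const.sub χ.contDiff).smul contDiff_id)
  have hcoord : ∀ {f : EuclideanSpace ℝ (Fin N) → EuclideanSpace ℝ (Fin N)},
      ContDiff ℝ 1 f → ∀ i, ContDiff ℝ 1 fun x => f x i := fun hf i =>
    contDiff_euclidean.1 hf i
  have hdiff : ∀ {f : EuclideanSpace ℝ (Fin N) → EuclideanSpace ℝ (Fin N)},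
      ContDiff ℝ 1 f → ∀ x i, DifferentiableAt ℝ (fun x => f x i) x := fun hf x i =>
    (hcoord hf i).differentiable one_ne_zero x
  have hgz : ∀ x, 1 ≤ ‖x‖ → ∏ i, b (g x i) = 0 := fun x hx => by
    by_contra hne
    exact absurd (hsupp _ hne)
      (not_lt.2 (half_le_norm_interpolation hx (hbd x hx) χ.nonneg χ.le_one))
  have hhz : ∀ x, 1 ≤ ‖x‖ → ∏ i, b (h x i) = 0 := fun x hx => by
    by_contra hne
    have := half_le_norm_interpolation hx (hbd x hx) zero_le_one le_rfl
    rw [sub_self, zero_smul, add_zero, one_smul] at this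
    exact absurd (hsupp _ hne) (not_lt.2 this)
  have hpt : ∀ x, (∏ i, b (h x i)) * covDet N (fun i => fderiv ℝ (fun x => h x i) x)
      = (∏ i, b (g x i)) * covDet N (fun i => fderiv ℝ (fun x => g x i) x) := by
    intro x
    rcases le_or_gt 1 ‖x‖ with hx | hx
    · rw [hgz x hx, hhz x hx, zero_mul, zero_mul]
    · have hev : g =ᶠ[nhds x] h := by
        have : ball (0 : EuclideanSpace ℝ (Fin N)) (3 / 2) ∈ nhds x :=
          isOpen_ball.mem_nhds (by rw [mem_ball, dist_zero_right]; linarith)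
        filter_upwards [this] with y hy
        have h1 : χ y = 1 := χ.one_of_mem_closedBall (ball_subset_closedBall hy)
        simp [hg, h1]
      have h1 : ∀ i, fderiv ℝ (fun x => g x i) x = fderiv ℝ (fun x => h x i) x := fun i =>
        Filter.EventuallyEq.fderiv_eq (hev.mono fun y hy => by simp only [hy])
      simp only [h1, hev.self_of_nhds]
  have hid : ∀ x : EuclideanSpace ℝ (Fin N),
      covDet N (fun i => fderiv ℝ (fun x : EuclideanSpace ℝ (Fin N) => x i) x) = 1 := by
    intro x
    have h1 := det_eq_covDet (ContinuousLinearMap.id ℝ (EuclideanSpace ℝ (Fin N)))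
    rw [show (ContinuousLinearMap.id ℝ (EuclideanSpace ℝ (Fin N))).det = 1 by
      simp [ContinuousLinearMap.det]] at h1
    rw [h1]
    congr 1
    funext i
    exact (EuclideanSpace.proj i : EuclideanSpace ℝ (Fin N) →L[ℝ] ℝ).hasFDerivAt.fderiv
  have hβc : ∀ {f : EuclideanSpace ℝ (Fin N) → EuclideanSpace ℝ (Fin N)},
      ContDiff ℝ 1 f → ∀ i, ContDiff ℝ 1 fun x => β (f x i) := fun hf i =>
    hβ1.comp (hcoord hf i)
  -- β ∘ g and β ∘ id differ by a compactly supported map, so their Jacobians have the same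
  -- integral.
  have hkey := integral_covDet_fderiv_sub_eq_zero (u := fun i x => β (g x i))
    (v := fun i x => β (x i)) (hβc hg1) (hβc contDiff_id) (fun i => by
      refine HasCompactSupport.of_support_subset_isCompact (isCompact_closedBall 0 2)
        fun x hx => ?_
      by_contra hcon
      refine hx ?_
      have h0 : χ x = 0 := χ.zero_of_le_dist (by
        simp only [mem_closedBall, not_le] at hcon; exact hcon.le)
      simp [hg, h0])
  have hpt2 : ∀ x, covDet N (fun i => fderiv ℝ (fun x => β (g x i)) x)
        - covDet N (fun i => fderiv ℝ (fun x : EuclideanSpace ℝ (Fin N) => β (x i)) x)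
      = (∏ i, b (h x i)) * covDet N (fun i => fderiv ℝ (fun x => h x i) x) - ∏ i, b (x i) := by
    intro x
    rw [hpt, covDet_fderiv_comp_real hβ (hdiff hg1 x),
      covDet_fderiv_comp_real (u := fun i x => x i) hβ (hdiff contDiff_id x), hid, mul_one]
  simp only [hpt2] at hkey
  have hi1 : Integrable fun x =>
      (∏ i, b (h x i)) * covDet N (fun i => fderiv ℝ (fun x => h x i) x) := by
    refine Continuous.integrable_of_hasCompactSupport ?_ ?_
    · exact (continuous_finsetProd _ fun i _ => hb.comp (hcoord hh i).continuous).mul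
        (continuous_covDet_fderiv (hcoord hh))
    · refine HasCompactSupport.of_support_subset_isCompact (isCompact_closedBall 0 1)
        fun x hx => ?_
      by_contra hcon
      simp only [mem_closedBall, dist_zero_right, not_le] at hcon
      exact hx (by simp only [hhz x hcon.le, zero_mul])
  have hi2 : Integrable fun x : EuclideanSpace ℝ (Fin N) => ∏ i, b (x i) := by
    refine Continuous.integrable_of_hasCompactSupport ?_ ?_
    · exact continuous_finsetProd _ fun i _ => hb.comp (hcoord contDiff_id i).continuous
    · refine HasCompactSupport.of_support_subset_isCompact (isCompact_closedBall 0 (1 / 2))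
        fun x hx => ?_
      rw [mem_closedBall, dist_zero_right]
      exact (hsupp x hx).le
  rw [integral_sub hi1 hi2] at hkey
  linarith

/-- A product bump function concentrated near the origin. -/
theorem exists_bump_prod (N : ℕ) : ∃ b : ℝ → ℝ, ContDiff ℝ 1 b ∧
    (∀ y : EuclideanSpace ℝ (Fin N), ∏ i, b (y i) ≠ 0 → ‖y‖ < 1 / 2) ∧
    0 < ∫ x : EuclideanSpace ℝ (Fin N), ∏ i, b (x i) := by
  let b : ContDiffBump (0 : ℝ) :=
    ⟨1 / (8 * (N + 1)), 1 / (4 * (N + 1)), by positivity, by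
      apply one_div_lt_one_div_of_lt <;> [positivity; nlinarith [Nat.cast_nonneg (α := ℝ) N]]⟩
  have hbs : ∀ y : EuclideanSpace ℝ (Fin N), ∏ i, b (y i) ≠ 0 → ‖y‖ < 1 / 2 := by
    intro y hy
    rw [Finset.prod_ne_zero_iff] at hy
    have h1 : ∀ i, y i ^ 2 ≤ (1 / (4 * ((N : ℝ) + 1))) ^ 2 := fun i => by
      have h2 : y i ∈ Function.support b := hy i (Finset.mem_univ i)
      rw [b.support_eq, mem_ball, dist_zero_right, Real.norm_eq_abs] at h2
      rw [← sq_abs]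
      exact pow_le_pow_left₀ (abs_nonneg _) h2.le 2
    have h2 : ‖y‖ ^ 2 ≤ N * (1 / (4 * ((N : ℝ) + 1))) ^ 2 := by
      rw [EuclideanSpace.norm_sq_eq]
      refine (Finset.sum_le_sum fun i _ => ?_).trans
        (b := ∑ _i : Fin N, (1 / (4 * ((N : ℝ) + 1))) ^ 2) (by simp)
      rw [Real.norm_eq_abs, sq_abs]
      exact h1 i
    -- The radius 1/(4(N+1)) is chosen so that a cube of this half-width lies in the ball of radius
    -- 1/2.
    have h3 : N * (1 / (4 * ((N : ℝ) + 1))) ^ 2 < (1 / 2) ^ 2 := by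
      have hN : (0 : ℝ) ≤ N := N.cast_nonneg
      rw [div_pow, one_pow, mul_one_div, div_lt_iff₀ (by positivity)]
      nlinarith
    exact lt_of_pow_lt_pow_left₀ 2 (by norm_num) (h2.trans_lt h3)
  refine ⟨b, b.contDiff, hbs, ?_⟩
  have hcont : Continuous fun x : EuclideanSpace ℝ (Fin N) => ∏ i, b (x i) :=
    continuous_finsetProd _ fun i _ => b.continuous.comp
      (EuclideanSpace.proj i : EuclideanSpace ℝ (Fin N) →L[ℝ] ℝ).continuous
  have hcs : HasCompactSupport fun x : EuclideanSpace ℝ (Fin N) => ∏ i, b (x i) :=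
    HasCompactSupport.of_support_subset_isCompact (isCompact_closedBall 0 (1 / 2))
      fun x hx => by
        rw [mem_closedBall, dist_zero_right]
        exact (hbs x hx).le
  refine hcont.integral_pos_of_hasCompactSupport_nonneg_nonzero hcs
    (fun x => Finset.prod_nonneg fun i _ => b.nonneg) (x := 0) ?_
  have h0 : b 0 = 1 := b.one_of_mem_closedBall (mem_closedBall_self (by positivity))
  simp [h0]

end Degree

/-! ### The symplectic linear algebra behind divisibility by dα. -/

section Lefschetz

open Function

/-- Expand the product over subsets of P. A proper subset misses some slot, and summing β over that
slot gives 0; only the full subset survives. -/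
theorem sum_prod_one_add_smul_eq {P ι M : Type*} [Fintype P] [DecidableEq P] [Fintype ι]
    [AddCommGroup M] [Module ℝ M] (β : (P → ι) → M)
    (hβ : ∀ s j, ∑ t, β (update s j t) = 0) (g : ι → ℝ) :
    ∑ s : P → ι, (∏ j, (1 + g (s j))) • β s = ∑ s : P → ι, (∏ j, g (s j)) • β s := by
  have hD : ∀ D : Finset P, D ≠ Finset.univ →
      ∑ s : P → ι, (∏ j ∈ D, g (s j)) • β s = 0 := by
    intro D hD
    obtain ⟨j₀, hj₀⟩ : ∃ j, j ∉ D := by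
      by_contra h
      exact hD (Finset.eq_univ_of_forall fun j => by_contra fun hj => h ⟨j, hj⟩)
    rw [← (Equiv.funSplitAt j₀ ι).symm.sum_comp, Fintype.sum_prod_type_right]
    refine Finset.sum_eq_zero fun r _ => ?_
    rcases isEmpty_or_nonempty ι with hι | ⟨⟨t₀⟩⟩
    · simp
    · have hup : ∀ t, (Equiv.funSplitAt j₀ ι).symm (t, r)
          = update ((Equiv.funSplitAt j₀ ι).symm (t₀, r)) j₀ t := by
        intro t
        funext j
        by_cases hj : j = j₀
        · subst hj; simp
        · simp [hj]
      have hg : ∀ t, ∏ j ∈ D, g ((Equiv.funSplitAt j₀ ι).symm (t, r) j)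
          = ∏ j ∈ D, g ((Equiv.funSplitAt j₀ ι).symm (t₀, r) j) := by
        intro t
        refine Finset.prod_congr rfl fun j hj => ?_
        rw [hup, update_of_ne (by rintro rfl; exact hj₀ hj)]
      simp only [hg]
      rw [← Finset.smul_sum]
      rw [Finset.sum_congr rfl fun t _ => congrArg β (hup t), hβ, smul_zero]
  simp only [Finset.prod_one_add, Finset.sum_smul]
  rw [Finset.sum_comm, Finset.sum_eq_single_of_mem Finset.univ (by simp)
    fun D _ hne => hD D hne]

/-- An alternating function of `n + 1` indices in a symplectic basis of `ℝ²ⁿ` whose contraction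
with the symplectic form vanishes is zero. -/
theorem eq_zero_of_symplectic_contraction_eq_zero {n : ℕ} {L M : Type*} [Fintype L]
    [DecidableEq L] [AddCommGroup M] [Module ℝ M] (hL : n < Fintype.card L)
    (B : (L → Fin n ⊕ Fin n) → M)
    (hperm : ∀ v (σ : Equiv.Perm L), B (v ∘ σ) = Equiv.Perm.sign σ • B v)
    (hinj : ∀ v, ¬ Injective v → B v = 0)
    (hcontr : ∀ v a b, a ≠ b → ∑ j, B (update (update v a (.inl j)) b (.inr j)) = 0)
    (v : L → Fin n ⊕ Fin n) : B v = 0 := by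
  by_cases hv : Injective v
  swap
  · exact hinj v hv
  -- I and J collect the j whose x_j, respectively y_j, occurs in v. The count |I ∪ J| + |I ∩ J| > n
  -- shows that complete pairs outnumber the indices absent from v.
  set I := (Finset.univ.image v).toLeft with hI
  set J := (Finset.univ.image v).toRight with hJ
  have hmI : ∀ t, t ∈ I ↔ ∃ l, v l = .inl t := fun t => by simp [hI]
  have hmJ : ∀ t, t ∈ J ↔ ∃ l, v l = .inr t := fun t => by simp [hJ]
  have hcard : (I ∪ J)ᶜ.card < (I ∩ J).card := by
    have h1 := Finset.card_toLeft_add_card_toRight (u := Finset.univ.image v)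
    rw [Finset.card_image_of_injective _ hv, Finset.card_univ, ← hI, ← hJ] at h1
    have h2 := Finset.card_union_add_card_inter I J
    have h3 := Finset.card_compl (I ∪ J)
    have h4 : (I ∪ J).card ≤ n := (Finset.card_le_univ _).trans (by simp)
    rw [Fintype.card_fin] at h3
    omega
  set P := {t // t ∈ I ∩ J} with hP
  have hPI : ∀ j : P, ∃ l, v l = .inl j.1 := fun j =>
    (hmI _).1 (Finset.mem_inter.1 j.2).1
  have hPJ : ∀ j : P, ∃ l, v l = .inr j.1 := fun j =>
    (hmJ _).1 (Finset.mem_inter.1 j.2).2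
  choose a ha using hPI
  choose b hb using hPJ
  have ainj : Injective a := fun i j hij => by
    have := ha i
    rw [hij, ha j] at this
    exact Subtype.ext (Sum.inl_injective this).symm
  have binj : Injective b := fun i j hij => by
    have := hb i
    rw [hij, hb j] at this
    exact Subtype.ext (Sum.inr_injective this).symm
  have hab : ∀ i j, a i ≠ b j := fun i j hij => by
    have := ha i
    rw [hij, hb j] at this
    cases this
  -- Each complete pair (x_j, y_j) is replaced by (x_{s j}, y_{s j}); the unpaired entries stay.
  let vs : (P → Fin n) → L → Fin n ⊕ Fin n := fun s =>
    extend a (fun j => .inl (s j)) (extend b (fun j => .inr (s j)) v)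
  have vsa : ∀ s j, vs s (a j) = .inl (s j) := fun s j => ainj.extend_apply _ _ _
  have vsb : ∀ s j, vs s (b j) = .inr (s j) := fun s j => by
    simp only [vs]
    rw [extend_apply' _ _ _ (fun ⟨i, hi⟩ => hab i j hi), binj.extend_apply]
  have vso : ∀ s l, (∀ j, a j ≠ l) → (∀ j, b j ≠ l) → vs s l = v l := fun s l h1 h2 => by
    simp only [vs]
    rw [extend_apply' _ _ _ (fun ⟨i, hi⟩ => h1 i hi),
      extend_apply' _ _ _ (fun ⟨i, hi⟩ => h2 i hi)]
  have hcases : ∀ l, (∃ j, a j = l) ∨ (∃ j, b j = l) ∨ ((∀ j, a j ≠ l) ∧ ∀ j, b j ≠ l) := by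
    intro l
    by_cases h1 : ∃ j, a j = l
    · exact .inl h1
    by_cases h2 : ∃ j, b j = l
    · exact .inr (.inl h2)
    · exact .inr (.inr ⟨fun j hj => h1 ⟨j, hj⟩, fun j hj => h2 ⟨j, hj⟩⟩)
  have vscoe : vs (fun j => j.1) = v := by
    funext l
    rcases hcases l with ⟨j, rfl⟩ | ⟨j, rfl⟩ | ⟨h1, h2⟩
    · rw [vsa, ha]
    · rw [vsb, hb]
    · exact vso _ _ h1 h2
  have hslot : ∀ s j, ∑ t, B (vs (update s j t)) = 0 := by
    intro s j
    rw [← hcontr (vs s) (a j) (b j) (hab j j)]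
    refine Finset.sum_congr rfl fun t _ => congrArg B ?_
    funext l
    rcases hcases l with ⟨i, rfl⟩ | ⟨i, rfl⟩ | ⟨h1, h2⟩
    · rw [vsa, update_of_ne (hab i j)]
      by_cases hij : i = j
      · subst hij; simp
      · rw [update_of_ne hij, update_of_ne (ainj.ne hij), vsa]
    · rw [vsb]
      by_cases hij : i = j
      · subst hij; simp
      · rw [update_of_ne hij, update_of_ne (binj.ne hij), update_of_ne (hab j i).symm, vsb]
    · rw [update_of_ne (h2 j).symm, update_of_ne (h1 j).symm, vso _ _ h1 h2, vso _ _ h1 h2]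
  have hsinj : ∀ s, ¬ Injective s → B (vs s) = 0 := fun s hs => hinj _ fun h =>
    hs fun i j hij => ainj (h (by rw [vsa, vsa, hij]))
  -- Such an s j already occurs unpaired in v, so the new pair repeats an entry.
  have hsmem : ∀ s j, s j ∉ I ∩ J → s j ∈ I ∪ J → B (vs s) = 0 := by
    intro s j h1 h2
    have hP' : ∀ i : P, i.1 ≠ s j := fun i hi => h1 (hi ▸ i.2)
    refine hinj _ fun h => ?_
    rcases Finset.mem_union.1 h2 with h3 | h3
    · obtain ⟨l, hl⟩ := (hmI _).1 h3
      have hla : ∀ i, a i ≠ l := fun i hi => by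
        rw [← hi, ha] at hl
        exact hP' i (Sum.inl_injective hl)
      have hlb : ∀ i, b i ≠ l := fun i hi => by
        rw [← hi, hb] at hl
        cases hl
      exact hla j (h (by rw [vsa, vso _ _ hla hlb, hl]))
    · obtain ⟨l, hl⟩ := (hmJ _).1 h3
      have hla : ∀ i, a i ≠ l := fun i hi => by
        rw [← hi, ha] at hl
        cases hl
      have hlb : ∀ i, b i ≠ l := fun i hi => by
        rw [← hi, hb] at hl
        exact hP' i (Sum.inr_injective hl)
      exact hlb j (h (by rw [vsb, vso _ _ hla hlb, hl]))
  -- The x-slots and the y-slots undergo the same permutation, so the two signs cancel.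
  have hsymm : ∀ π : Equiv.Perm P, B (vs fun j => (π j).1) = B v := by
    intro π
    classical
    set σ := π.extendDomain (Equiv.ofInjective a ainj)
    set τ := π.extendDomain (Equiv.ofInjective b binj)
    have hσa : ∀ j, σ (a j) = a (π j) := fun j =>
      Equiv.Perm.extendDomain_apply_image π (Equiv.ofInjective a ainj) j
    have hτb : ∀ j, τ (b j) = b (π j) := fun j =>
      Equiv.Perm.extendDomain_apply_image π (Equiv.ofInjective b binj) j
    have hσ : ∀ l, (∀ j, a j ≠ l) → σ l = l := fun l hl =>
      Equiv.Perm.extendDomain_apply_not_subtype _ _ fun ⟨j, hj⟩ => hl j hj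
    have hτ : ∀ l, (∀ j, b j ≠ l) → τ l = l := fun l hl =>
      Equiv.Perm.extendDomain_apply_not_subtype _ _ fun ⟨j, hj⟩ => hl j hj
    have hvs : (vs fun j => (π j).1) = v ∘ ⇑(σ * τ) := by
      funext l
      simp only [comp_apply, Equiv.Perm.mul_apply]
      rcases hcases l with ⟨j, rfl⟩ | ⟨j, rfl⟩ | ⟨h1, h2⟩
      · rw [vsa, hτ _ fun i => (hab j i).symm, hσa, ha]
      · rw [vsb, hτb, hσ _ fun i => hab i _, hb]
      · rw [vso _ _ h1 h2, hτ _ h2, hσ _ h1]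
    rw [hvs, hperm, Equiv.Perm.sign_mul, Equiv.Perm.sign_extendDomain,
      Equiv.Perm.sign_extendDomain, Int.units_mul_self, one_smul]
  -- The weight 1 + g is the indicator of I ∪ J. On the right only s avoiding I ∪ J contribute, and
  -- none of them is injective by the count above; on the left exactly the permutations of P remain,
  -- so |P|! • B v = 0.
  have hmain := sum_prod_one_add_smul_eq (fun s => B (vs s)) hslot
    (fun t => if t ∈ I ∪ J then 0 else -1)
  have hright : ∑ s : P → Fin n, (∏ j, (if s j ∈ I ∪ J then (0 : ℝ) else -1)) • B (vs s) = 0 := by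
    refine Finset.sum_eq_zero fun s _ => ?_
    by_cases h : ∃ j, s j ∈ I ∪ J
    · obtain ⟨j, hj⟩ := h
      rw [Finset.prod_eq_zero (Finset.mem_univ j) (by rw [if_pos hj]), zero_smul]
    · rw [hsinj s, smul_zero]
      intro hs
      have h' : ∀ j, s j ∈ (I ∪ J)ᶜ := fun j =>
        Finset.mem_compl.2 fun hj => h ⟨j, hj⟩
      have := Finset.card_le_card_of_injOn (s := Finset.univ) s (fun j _ => h' j) hs.injOn
      rw [Finset.card_univ, Fintype.card_coe] at this
      omega
  have hleft : ∑ s : P → Fin n, (∏ j, (1 + if s j ∈ I ∪ J then (0 : ℝ) else -1)) • B (vs s)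
      = ∑ _π : Equiv.Perm P, B v := by
    symm
    refine Fintype.sum_of_injective (fun (π : Equiv.Perm P) (j : P) => (π j).1) ?_ _ _ ?_ ?_
    · intro π ρ h
      ext j
      exact congrArg Fin.val (congrFun h j)
    · intro s hs
      by_cases h1 : ∀ j, s j ∈ I ∩ J
      · rw [hsinj s, smul_zero]
        intro hs'
        have hbij : Bijective fun j => (⟨s j, h1 j⟩ : P) :=
          Finite.injective_iff_bijective.1 fun i j hij => hs' (congrArg Subtype.val hij)
        exact hs ⟨Equiv.ofBijective _ hbij, rfl⟩
      · obtain ⟨j, hj⟩ := not_forall.1 h1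
        by_cases h2 : s j ∈ I ∪ J
        · rw [hsmem s j hj h2, smul_zero]
        · rw [Finset.prod_eq_zero (Finset.mem_univ j) (by rw [if_neg h2]; ring), zero_smul]
    · intro π
      rw [hsymm, Finset.prod_eq_one, one_smul]
      intro j _
      have := (π j).2
      rw [if_pos (Finset.mem_union_left _ (Finset.mem_inter.1 this).1), add_zero]
  rw [hleft, hright, Finset.sum_const, ← Nat.cast_smul_eq_nsmul ℝ] at hmain
  refine (smul_eq_zero.1 hmain).resolve_left ?_
  exact Nat.cast_ne_zero.2 (Finset.card_ne_zero.2 ⟨Equiv.refl _, Finset.mem_univ _⟩)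

end Lefschetz

/-! ### Mollification at unit scale. -/

section Mollification

open MeasureTheory Metric Set Module
open scoped Convolution

/-- Convolution with a normalized bump φ, with K the L¹ norm of Dφ. The functional l and the point z
are quantified after v, so that l may be the contact form frozen at a value depending on z. -/
theorem exists_mollifier (E : Type*) [NormedAddCommGroup E] [InnerProductSpace ℝ E]
    [FiniteDimensional ℝ E] [MeasurableSpace E] [BorelSpace E] :
    ∃ K : ℝ, 0 ≤ K ∧ ∀ {W : Type} [NormedAddCommGroup W] [NormedSpace ℝ W] [CompleteSpace W]
      {u : E → W}, Continuous u → ∃ v : E → W, ContDiff ℝ 1 v ∧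
        ∀ {F : Type} [NormedAddCommGroup F] [NormedSpace ℝ F] [CompleteSpace F] (l : W →L[ℝ] F)
          (z : E) (S : ℝ), (∀ w, ‖w‖ ≤ 1 → ‖l (u (z - w) - u z)‖ ≤ S) →
          ‖l (v z - u z)‖ ≤ S ∧ ∀ e, ‖l (fderiv ℝ v z e)‖ ≤ K * S * ‖e‖ := by
  let b : ContDiffBump (0 : E) := ⟨1 / 2, 1, by norm_num, by norm_num⟩
  set φ : E → ℝ := b.normed volume with hφ
  have hφ1 : ContDiff ℝ 1 φ := b.contDiff_normed
  have hφc : HasCompactSupport φ := b.hasCompactSupport_normed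
  have hφi : ∫ x, φ x = 1 := b.integral_normed
  have hφ0 : ∀ x, 0 ≤ φ x := b.nonneg_normed
  have hφs : tsupport φ = closedBall 0 1 := b.tsupport_normed_eq
  have hDi : Integrable fun x => ‖fderiv ℝ φ x‖ :=
    ((hφ1.continuous_fderiv one_ne_zero).integrable_of_hasCompactSupport (hφc.fderiv ℝ)).norm
  refine ⟨∫ x, ‖fderiv ℝ φ x‖, integral_nonneg fun x => norm_nonneg _, ?_⟩
  intro W _ _ _ u hu
  let L : ℝ →L[ℝ] W →L[ℝ] W := ContinuousLinearMap.lsmul ℝ ℝ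
  refine ⟨φ ⋆[L, volume] u, hφc.contDiff_convolution_left L (n := 1) hφ1 hu.locallyIntegrable, ?_⟩
  intro F _ _ _ l z S hS
  have hu' : Continuous fun x => u x - u z := hu.sub continuous_const
  have hz' : Continuous fun w => u (z - w) - u z :=
    hu'.comp (continuous_const.sub continuous_id)
  have hzero : ∀ w, 1 < ‖w‖ → φ w = 0 ∧ fderiv ℝ φ w = 0 := by
    intro w hw
    have : w ∉ tsupport φ := by
      rw [hφs, mem_closedBall, dist_zero_right]
      exact not_le.2 hw
    exact ⟨image_eq_zero_of_notMem_tsupport this, by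
      by_contra h
      exact this (support_fderiv_subset ℝ h)⟩
  -- As φ has mass 1, u may be recentred at u z, and the estimates see only its oscillation near z.
  have hvz : ∀ x, (φ ⋆[L, volume] u) x = (φ ⋆[L, volume] fun x => u x - u z) x + u z := by
    intro x
    have hconst : ∫ w, φ w • u z = u z := by
      rw [integral_smul_const, hφi, one_smul]
    have hcx : Continuous fun w => u (x - w) - u z :=
      hu'.comp (continuous_const.sub continuous_id)
    simp only [convolution_def, L, ContinuousLinearMap.lsmul_apply]
    conv_rhs => rw [← hconst]
    rw [← integral_add]
    · refine integral_congr_ae (Filter.Eventually.of_forall fun w => ?_)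
      simp only
      rw [hconst, ← smul_add, sub_add_cancel]
    · rw [hconst]
      exact (hφ1.continuous.smul hcx).integrable_of_hasCompactSupport hφc.smul_right
    · exact (hφ1.continuous.smul continuous_const).integrable_of_hasCompactSupport hφc.smul_right
  constructor
  · rw [hvz, add_sub_cancel_right, convolution_def]
    simp only [L, ContinuousLinearMap.lsmul_apply]
    have hi0 : Integrable fun w => φ w • (u (z - w) - u z) :=
      (hφ1.continuous.smul hz').integrable_of_hasCompactSupport hφc.smul_right
    rw [← l.integral_comp_comm hi0]
    calc _ ≤ ∫ w, φ w * S := by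
          refine norm_integral_le_of_norm_le (b.integrable_normed.mul_const S)
            (Filter.Eventually.of_forall fun w => ?_)
          rw [map_smul, norm_smul, Real.norm_of_nonneg (hφ0 w)]
          rcases le_or_gt ‖w‖ 1 with hw | hw
          · exact mul_le_mul_of_nonneg_left (hS w hw) (hφ0 w)
          · rw [(hzero w hw).1, zero_mul, zero_mul]
      _ = S := by rw [integral_mul_const, hφi, one_mul]
  · intro e
    have hd := (hφc.hasFDerivAt_convolution_left L hφ1 hu'.locallyIntegrable z
      (μ := volume)).add_const (u z)
    rw [show (fun x => (φ ⋆[L, volume] fun x => u x - u z) x + u z) = φ ⋆[L, volume] u from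
      funext fun x => (hvz x).symm] at hd
    have hc1 : Continuous fun w => (L.precompL E) (fderiv ℝ φ w) (u (z - w) - u z) :=
      (((L.precompL E).continuous.comp (hφ1.continuous_fderiv one_ne_zero)).clm_apply hz')
    have hi1 : Integrable fun w => (L.precompL E) (fderiv ℝ φ w) (u (z - w) - u z) :=
      hc1.integrable_of_hasCompactSupport ((hφc.fderiv ℝ).mono fun w hw h => hw (by
        simp only [h, map_zero, zero_apply]))
    rw [hd.fderiv, convolution_def, ContinuousLinearMap.integral_apply hi1,
      ← l.integral_comp_comm (hi1.apply_continuousLinearMap e)]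
    calc _ ≤ ∫ w, ‖fderiv ℝ φ w‖ * (S * ‖e‖) := by
          refine norm_integral_le_of_norm_le (hDi.mul_const _)
            (Filter.Eventually.of_forall fun w => ?_)
          rw [ContinuousLinearMap.precompL_apply]
          simp only [L, ContinuousLinearMap.lsmul_apply]
          rw [map_smul, norm_smul]
          rcases le_or_gt ‖w‖ 1 with hw | hw
          · calc _ ≤ (‖fderiv ℝ φ w‖ * ‖e‖) * S := by
                  refine mul_le_mul (ContinuousLinearMap.le_opNorm _ _) (hS w hw)
                    (norm_nonneg _) (by positivity)
              _ = _ := by ring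
          · rw [(hzero w hw).2, zero_apply, norm_zero, norm_zero, zero_mul,
              zero_mul]
      _ = _ := by rw [integral_mul_const, mul_assoc]

end Mollification

/-! ### The contact form and the Korányi distance. -/

section Contact

open MeasureTheory Metric Set Module

/-- `ℝ²ⁿ⁺¹` with its Euclidean norm. -/
abbrev HeisenbergSpace (n : ℕ) := EuclideanSpace ℝ (Fin n ⊕ Fin n ⊕ Unit)

namespace HeisenbergSpace

variable {n : ℕ}

/-- The index of `x_j` or of `y_j` among the coordinates of `ℝ²ⁿ⁺¹`. -/
def horIndex : Fin n ⊕ Fin n → Fin n ⊕ Fin n ⊕ Unit := Sum.map id Sum.inl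

/-- A coordinate as a covector. -/
noncomputable def coord (a : Fin n ⊕ Fin n ⊕ Unit) : HeisenbergSpace n →L[ℝ] ℝ :=
  EuclideanSpace.proj a

@[simp] theorem coord_apply (a : Fin n ⊕ Fin n ⊕ Unit) (p : HeisenbergSpace n) :
    coord a p = p a := rfl

theorem abs_apply_le (p : HeisenbergSpace n) (a) : |p a| ≤ ‖p‖ :=
  PiLp.norm_apply_le p a

/-- The contact form `dt + 2 ∑ (xⱼ dyⱼ - yⱼ dxⱼ)` at the point `p`. -/
noncomputable def contact (p : HeisenbergSpace n) : HeisenbergSpace n →L[ℝ] ℝ :=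
  coord (.inr (.inr ())) + ∑ j, ((2 * p (.inl j)) • coord (.inr (.inl j))
    - (2 * p (.inr (.inl j))) • coord (.inl j))

theorem contact_apply (p w : HeisenbergSpace n) :
    contact p w = w (.inr (.inr ())) + ∑ j, (2 * p (.inl j) * w (.inr (.inl j))
      - 2 * p (.inr (.inl j)) * w (.inl j)) := by
  simp [contact]

theorem abs_coord_sub_le_dist (p q : Heisenberg n) (a : Fin n ⊕ Fin n) :
    |coord (horIndex a) (p.toEuclidean - q.toEuclidean)| ≤ dist p q := by
  rw [Heisenberg.dist_def]
  refine abs_le_of_sq_le_sq (le_trans ?_ (pow_le_pow_left₀ (norm_nonneg _)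
    (Heisenberg.norm_hor_le _) 2)) (Heisenberg.koranyiNorm_nonneg _)
  rw [Heisenberg.norm_hor_sq]
  have key : ∀ j, (q⁻¹ * p).x j ^ 2 + (q⁻¹ * p).y j ^ 2 ≤ (q⁻¹ * p).horSq := fun j =>
    Finset.single_le_sum (f := fun j => (q⁻¹ * p).x j ^ 2 + (q⁻¹ * p).y j ^ 2)
      (fun _ _ => by positivity) (Finset.mem_univ j)
  rcases a with j | j
  · refine le_trans (le_of_eq ?_) ((le_add_of_nonneg_right (sq_nonneg _)).trans (key j))
    simp [horIndex, Heisenberg.toEuclidean]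
    ring
  · refine le_trans (le_of_eq ?_) ((le_add_of_nonneg_left (sq_nonneg _)).trans (key j))
    simp [horIndex, Heisenberg.toEuclidean]
    ring

/-- The left side is exactly the vertical coordinate of q⁻¹ * p, which the squared Korányi norm
dominates. -/
theorem abs_contact_sub_le_dist_sq (p q : Heisenberg n) :
    |contact q.toEuclidean (p.toEuclidean - q.toEuclidean)| ≤ dist p q ^ 2 := by
  rw [Heisenberg.dist_def, Heisenberg.koranyiNorm_sq]
  refine le_trans (le_of_eq ?_) (Complex.abs_im_le_norm _)
  congr 1
  simp only [contact_apply, Heisenberg.toEuclidean, PiLp.sub_apply, Sum.elim_inr, Sum.elim_inl,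
    Heisenberg.mul_t, Heisenberg.inv_x, Heisenberg.inv_y, Heisenberg.inv_t, Pi.neg_apply,
    Finset.mul_sum]
  rw [← sub_eq_neg_add, add_left_cancel_iff]
  exact Finset.sum_congr rfl fun j _ => by ring

/-- Only horizontal coordinates enter. In the mollification both factors are thus controlled by the
Korányi oscillation, and moving the base point costs only its square. -/
theorem contact_sub_contact (p q w : HeisenbergSpace n) :
    contact p w - contact q w = ∑ j, (2 * (p - q) (.inl j) * w (.inr (.inl j))
      - 2 * (p - q) (.inr (.inl j)) * w (.inl j)) := by
  rw [contact_apply, contact_apply, add_sub_add_left_eq_sub, ← Finset.sum_sub_distrib]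
  exact Finset.sum_congr rfl fun j _ => by simp only [PiLp.sub_apply]; ring

/-- Mollification at unit scale: a map with small Korányi oscillation is approximated by a smooth map
with small pulled-back contact form. -/
theorem exists_mollification (N n : ℕ) : ∃ C : ℝ, 0 ≤ C ∧
    ∀ (g : EuclideanSpace ℝ (Fin N) → Heisenberg n) (δ η : ℝ), 0 ≤ δ → 0 ≤ η →
      (Continuous fun z => (g z).toEuclidean) →
      (∀ p q, dist p q ≤ 1 → dist (g p) (g q) ≤ δ) →
      (∀ p q, dist p q ≤ 1 → dist (g p).toEuclidean (g q).toEuclidean ≤ η) →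
      ∃ v : EuclideanSpace ℝ (Fin N) → HeisenbergSpace n, ContDiff ℝ 1 v ∧ ∀ z,
        ‖v z - (g z).toEuclidean‖ ≤ η ∧ ‖fderiv ℝ v z‖ ≤ C * η ∧
        ‖(contact (v z)).comp (fderiv ℝ v z)‖ ≤ C * δ ^ 2 := by
  obtain ⟨K, hK, hmol⟩ := exists_mollifier (EuclideanSpace ℝ (Fin N))
  -- K comes from the contact form frozen at g z, and 4K per coordinate pair from moving the base
  -- point to v z.
  refine ⟨K + n * (4 * K), by positivity, fun g δ η hδ hη hg hgδ hgη => ?_⟩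
  obtain ⟨v, hv, hest⟩ := hmol hg
  have hclose : ∀ z w : EuclideanSpace ℝ (Fin N), ‖w‖ ≤ 1 → dist (z - w) z ≤ 1 := by
    intro z w hw
    rwa [dist_eq_norm, sub_sub_cancel_left, norm_neg]
  refine ⟨v, hv, fun z => ?_⟩
  obtain ⟨h1, h2⟩ := hest (ContinuousLinearMap.id ℝ (HeisenbergSpace n)) z η fun w hw => by
    have := hgη _ _ (hclose z w hw)
    rwa [dist_eq_norm] at this
  have hc : ∀ a : Fin n ⊕ Fin n, |(v z - (g z).toEuclidean) (horIndex a)| ≤ δ ∧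
      ∀ e, |fderiv ℝ v z e (horIndex a)| ≤ K * δ * ‖e‖ := fun a =>
    hest (coord (horIndex a)) z δ fun w hw =>
      (abs_coord_sub_le_dist _ _ a).trans (hgδ _ _ (hclose z w hw))
  obtain ⟨-, h3⟩ := hest (contact (g z).toEuclidean) z (δ ^ 2) fun w hw =>
    (abs_contact_sub_le_dist_sq _ _).trans
      (pow_le_pow_left₀ dist_nonneg (hgδ _ _ (hclose z w hw)) 2)
  refine ⟨h1, ?_, ?_⟩
  · refine ContinuousLinearMap.opNorm_le_bound _ (by positivity) fun e => (h2 e).trans ?_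
    gcongr
    have : 0 ≤ (n : ℝ) * (4 * K) := by positivity
    linarith
  · refine ContinuousLinearMap.opNorm_le_bound _ (by positivity) fun e => ?_
    set w := fderiv ℝ v z e with hw
    have h4 : |contact (v z) w - contact (g z).toEuclidean w| ≤ n * (4 * K) * δ ^ 2 * ‖e‖ := by
      rw [contact_sub_contact]
      refine (Finset.abs_sum_le_sum_abs _ _).trans ?_
      refine (Finset.sum_le_sum (g := fun _ => 4 * K * δ ^ 2 * ‖e‖) fun j _ => ?_).trans
        (le_of_eq (by simp; ring))
      have hx := hc (.inl j)
      have hy := hc (.inr j)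
      have e1 := mul_le_mul hx.1 (hy.2 e) (abs_nonneg _) hδ
      have e2 := mul_le_mul hy.1 (hx.2 e) (abs_nonneg _) hδ
      simp only [horIndex, Sum.map_inl, Sum.map_inr, id] at e1 e2
      refine (abs_sub _ _).trans ?_
      rw [mul_assoc, mul_assoc, abs_mul, abs_mul, abs_mul, abs_mul, abs_two]
      nlinarith
    have h5 : |contact (v z) w| ≤ K * δ ^ 2 * ‖e‖ + n * (4 * K) * δ ^ 2 * ‖e‖ := by
      have h6 : |contact (g z).toEuclidean w| ≤ K * δ ^ 2 * ‖e‖ := h3 e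
      have := abs_add_le (contact (g z).toEuclidean w)
        (contact (v z) w - contact (g z).toEuclidean w)
      rw [add_sub_cancel] at this
      linarith
    rw [ContinuousLinearMap.comp_apply, Real.norm_eq_abs]
    calc _ ≤ _ := h5
      _ = _ := by ring

end HeisenbergSpace

end Contact

/-! ### Integration by parts against the symplectic form. -/

section Contraction

open MeasureTheory Metric Set Module Function

theorem abs_covDet_le {n : ℕ} {φ : Fin (n + 1) → EuclideanSpace ℝ (Fin (n + 1)) →L[ℝ] ℝ}
    (b : Fin (n + 1)) {A B : ℝ} (hA : ‖φ b‖ ≤ A) (hB : ∀ i, i ≠ b → ‖φ i‖ ≤ B) :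
    |covDet (n + 1) φ| ≤ ‖covDetCLM (n + 1)‖ * (A * B ^ n) := by
  refine ((covDetCLM (n + 1)).le_opNorm φ).trans ?_
  gcongr
  rw [Fintype.prod_eq_mul_prod_compl b]
  have h : ∏ i ∈ {b}ᶜ, ‖φ i‖ ≤ B ^ n := by
    refine (Finset.prod_le_prod (fun _ _ => norm_nonneg _) fun i hi => hB i (by simpa using hi)).trans
      (le_of_eq ?_)
    simp [Finset.card_compl]
  exact mul_le_mul hA h (Finset.prod_nonneg fun _ _ => norm_nonneg _) ((norm_nonneg _).trans hA)

theorem covDet_update_swap {N : ℕ} (m : Fin N → EuclideanSpace ℝ (Fin N) →L[ℝ] ℝ) {a b : Fin N}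
    (hab : a ≠ b) (p q : EuclideanSpace ℝ (Fin N) →L[ℝ] ℝ) :
    covDet N (update (update m a p) b q) = -covDet N (update (update m a q) b p) := by
  rw [← (covDet N).map_swap _ hab]
  congr 1
  funext i
  rw [comp_apply]
  by_cases h1 : i = a
  · subst h1; simp [hab]
  by_cases h2 : i = b
  · subst h2; simp [hab]
  · rw [Equiv.swap_apply_of_ne_of_ne h1 h2]; simp [h1, h2]

/-- Evaluation of `covDet` on two distinguished slots, as a linear map in the last one. -/
noncomputable def covDetSlots {N : ℕ} (m : Fin N → EuclideanSpace ℝ (Fin N) →L[ℝ] ℝ)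
    (a b : Fin N) (p : EuclideanSpace ℝ (Fin N) →L[ℝ] ℝ) :
    (EuclideanSpace ℝ (Fin N) →L[ℝ] ℝ) →ₗ[ℝ] ℝ :=
  (covDet N).toMultilinearMap.toLinearMap (update m a p) b

theorem covDetSlots_apply {N : ℕ} (m : Fin N → EuclideanSpace ℝ (Fin N) →L[ℝ] ℝ)
    (a b : Fin N) (p q : EuclideanSpace ℝ (Fin N) →L[ℝ] ℝ) :
    covDetSlots m a b p q = covDet N (update (update m a p) b q) := rfl

namespace HeisenbergSpace

variable {n N : ℕ}

/-- Pointwise form of dc∧α = dc∧dt + 2∑(d(c xⱼ)∧dyⱼ - d(c yⱼ)∧dxⱼ) - 4c∑ dxⱼ∧dyⱼ. After integration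
all terms but the last are exact with compactly supported primitives. -/
theorem covDetSlots_contact {m : Fin N → EuclideanSpace ℝ (Fin N) →L[ℝ] ℝ} {a b : Fin N}
    (hab : a ≠ b) (p : HeisenbergSpace n) (T : EuclideanSpace ℝ (Fin N) →L[ℝ] HeisenbergSpace n)
    (c : ℝ) (dc : EuclideanSpace ℝ (Fin N) →L[ℝ] ℝ) :
    covDetSlots m a b dc ((contact p).comp T)
      = covDetSlots m a b dc ((coord (.inr (.inr ()))).comp T)
        + ∑ j, (2 * covDetSlots m a b
            (c • (coord (.inl j)).comp T + p (.inl j) • dc) ((coord (.inr (.inl j))).comp T)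
          - 2 * covDetSlots m a b
            (c • (coord (.inr (.inl j))).comp T + p (.inr (.inl j)) • dc)
              ((coord (.inl j)).comp T))
        - 4 * (c * ∑ j, covDetSlots m a b ((coord (.inl j)).comp T)
            ((coord (.inr (.inl j))).comp T)) := by
  have hsw : ∀ p q, covDetSlots m a b p q = -covDetSlots m a b q p := fun p q =>
    covDet_update_swap m hab p q
  have hadd : ∀ (s t : ℝ) p q r, covDetSlots m a b (s • p + t • q) r
      = s * covDetSlots m a b p r + t * covDetSlots m a b q r := by
    intro s t p q r
    rw [hsw, map_add, map_smul, map_smul, hsw r p, hsw r q, smul_eq_mul, smul_eq_mul]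
    ring
  have hcomp : (contact p).comp T = (coord (.inr (.inr ()))).comp T
      + ∑ j, ((2 * p (.inl j)) • (coord (.inr (.inl j))).comp T
        - (2 * p (.inr (.inl j))) • (coord (.inl j)).comp T) := by
    ext w
    simp [contact]
  rw [hcomp, map_add, map_sum, add_sub_assoc, add_left_cancel_iff, Finset.mul_sum,
    Finset.mul_sum, ← Finset.sum_sub_distrib]
  refine Finset.sum_congr rfl fun j _ => ?_
  rw [map_sub, map_smul, map_smul, hadd, hadd,
    hsw ((coord (.inr (.inl j))).comp T) ((coord (.inl j)).comp T), smul_eq_mul, smul_eq_mul]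
  ring

theorem fderiv_apply_eq {u : EuclideanSpace ℝ (Fin N) → HeisenbergSpace n} (hu : ContDiff ℝ 1 u)
    (a) (x : EuclideanSpace ℝ (Fin N)) :
    fderiv ℝ (fun y => u y a) x = (coord a).comp (fderiv ℝ u x) :=
  ((coord a).hasFDerivAt.comp x (hu.differentiable one_ne_zero x).hasFDerivAt).fderiv

theorem contDiff_apply {u : EuclideanSpace ℝ (Fin N) → HeisenbergSpace n} (hu : ContDiff ℝ 1 u)
    (a) : ContDiff ℝ 1 fun y => u y a :=
  (coord a).contDiff.comp hu

theorem integral_covDetSlots_fderiv {z : Fin N → EuclideanSpace ℝ (Fin N) → ℝ}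
    (hz : ∀ i, ContDiff ℝ 1 (z i)) {a b : Fin N} (hab : a ≠ b)
    {p q : EuclideanSpace ℝ (Fin N) → ℝ} (hp : ContDiff ℝ 1 p) (hq : ContDiff ℝ 1 q)
    (hc : HasCompactSupport p) :
    Integrable (fun x => covDetSlots (fun i => fderiv ℝ (z i) x) a b (fderiv ℝ p x)
      (fderiv ℝ q x)) ∧
    ∫ x, covDetSlots (fun i => fderiv ℝ (z i) x) a b (fderiv ℝ p x) (fderiv ℝ q x) = 0 := by
  set w := update (update z a p) b q with hw
  have hwd : ∀ i, ContDiff ℝ 1 (w i) := by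
    intro i
    by_cases h2 : i = b
    · subst h2; simpa [hw] using hq
    by_cases h1 : i = a
    · subst h1; simpa [hw, hab] using hp
    · simpa [hw, h1, h2] using hz i
  have hwa : w a = p := by simp [hw, hab]
  have heq : ∀ x, covDetSlots (fun i => fderiv ℝ (z i) x) a b (fderiv ℝ p x) (fderiv ℝ q x)
      = covDet N (fun i => fderiv ℝ (w i) x) := by
    intro x
    rw [covDetSlots_apply]
    congr 1
    funext i
    by_cases h2 : i = b
    · subst h2; simp [hw]
    by_cases h1 : i = a
    · subst h1; simp [hw, hab]
    · simp [hw, h1, h2]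
  simp only [heq]
  exact ⟨(continuous_covDet_fderiv hwd).integrable_of_hasCompactSupport
    (hasCompactSupport_covDet_fderiv a (hwa ▸ hc)),
    integral_covDet_fderiv_eq_zero hwd a (hwa ▸ hc)⟩

theorem continuous_covDetSlots {m : Fin N → EuclideanSpace ℝ (Fin N) →
      EuclideanSpace ℝ (Fin N) →L[ℝ] ℝ} (hm : ∀ i, Continuous (m i)) (a b : Fin N)
    {p q : EuclideanSpace ℝ (Fin N) → EuclideanSpace ℝ (Fin N) →L[ℝ] ℝ} (hp : Continuous p)
    (hq : Continuous q) : Continuous fun x => covDetSlots (fun i => m i x) a b (p x) (q x) :=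
  (continuous_covDet N).comp (((continuous_pi hm).update a hp).update b hq)

/-- Integration by parts turns the pulled-back symplectic form into the pulled-back contact form. -/
theorem integral_mul_sum_covDetSlots {u : EuclideanSpace ℝ (Fin N) → HeisenbergSpace n}
    (hu : ContDiff ℝ 1 u) {c : EuclideanSpace ℝ (Fin N) → ℝ} (hc : ContDiff ℝ 1 c)
    (hcs : HasCompactSupport c) (v : Fin N → Fin n ⊕ Fin n ⊕ Unit) {a b : Fin N} (hab : a ≠ b) :
    ∫ x, c x * ∑ j, covDetSlots (fun i => (coord (v i)).comp (fderiv ℝ u x)) a b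
        ((coord (.inl j)).comp (fderiv ℝ u x)) ((coord (.inr (.inl j))).comp (fderiv ℝ u x))
      = -(1 / 4) * ∫ x, covDetSlots (fun i => (coord (v i)).comp (fderiv ℝ u x)) a b
        (fderiv ℝ c x) ((contact (u x)).comp (fderiv ℝ u x)) := by
  have hz : ∀ i, ContDiff ℝ 1 fun y => u y (v i) := fun i => contDiff_apply hu (v i)
  -- The exact terms integrate to zero because c, c xⱼ and c yⱼ have compact support.
  obtain ⟨hi0, h0⟩ := integral_covDetSlots_fderiv hz hab hc (contDiff_apply hu (.inr (.inr ()))) hcs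
  have h1 : ∀ j, _ := fun j => integral_covDetSlots_fderiv hz hab
    (hc.mul (contDiff_apply hu (.inl j))) (contDiff_apply hu (.inr (.inl j))) hcs.mul_right
  have h2 : ∀ j, _ := fun j => integral_covDetSlots_fderiv hz hab
    (hc.mul (contDiff_apply hu (.inr (.inl j)))) (contDiff_apply hu (.inl j)) hcs.mul_right
  have hmul : ∀ j x, fderiv ℝ (fun x => c x * u x j) x
      = c x • (coord j).comp (fderiv ℝ u x) + u x j • fderiv ℝ c x := fun j x => by
    rw [fderiv_fun_mul (hc.differentiable one_ne_zero x)
      ((contDiff_apply hu j).differentiable one_ne_zero x), fderiv_apply_eq hu]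
  simp only [fderiv_apply_eq hu] at hi0 h0
  simp only [hmul, fderiv_apply_eq hu] at h1 h2
  have hcont : ∀ a, Continuous fun x => (coord a).comp (fderiv ℝ u x) := fun a =>
    continuous_const.clm_comp (hu.continuous_fderiv one_ne_zero)
  have hi3 : Integrable fun x => c x * ∑ j, covDetSlots
      (fun i => (coord (v i)).comp (fderiv ℝ u x)) a b
        ((coord (.inl j)).comp (fderiv ℝ u x)) ((coord (.inr (.inl j))).comp (fderiv ℝ u x)) := by
    refine Continuous.integrable_of_hasCompactSupport ?_ hcs.mul_right
    exact hc.continuous.mul (continuous_finsetSum _ fun j _ =>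
      continuous_covDetSlots (fun i => hcont (v i)) a b (hcont _) (hcont _))
  simp only [fun x => covDetSlots_contact (m := fun i => (coord (v i)).comp (fderiv ℝ u x)) hab
    (u x) (fderiv ℝ u x) (c x) (fderiv ℝ c x)]
  have hi12 : Integrable fun x => ∑ j, (2 * covDetSlots
      (fun i => (coord (v i)).comp (fderiv ℝ u x)) a b
      (c x • (coord (.inl j)).comp (fderiv ℝ u x) + u x (.inl j) • fderiv ℝ c x)
        ((coord (.inr (.inl j))).comp (fderiv ℝ u x))
      - 2 * covDetSlots (fun i => (coord (v i)).comp (fderiv ℝ u x)) a b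
        (c x • (coord (.inr (.inl j))).comp (fderiv ℝ u x) + u x (.inr (.inl j)) • fderiv ℝ c x)
          ((coord (.inl j)).comp (fderiv ℝ u x))) :=
    integrable_finsetSum _ fun j _ => ((h1 j).1.const_mul 2).sub ((h2 j).1.const_mul 2)
  rw [integral_sub ?_ (hi3.const_mul 4), integral_add hi0 hi12, h0, integral_finsetSum _ ?_,
    Finset.sum_congr rfl fun j _ => integral_sub ((h1 j).1.const_mul 2) ((h2 j).1.const_mul 2)]
  · simp only [integral_const_mul, fun j => (h1 j).2, fun j => (h2 j).2]
    simp
  · exact fun j _ => ((h1 j).1.const_mul 2).sub ((h2 j).1.const_mul 2)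
  · exact hi0.add hi12

end HeisenbergSpace

end Contraction

/-! ### Integrals of horizontal forms vanish in the limit. -/

section Vanishing

open MeasureTheory Metric Set Module Function Filter

theorem abs_integral_le_of_forall_norm_gt_one_eq_zero {N : ℕ} {f : EuclideanSpace ℝ (Fin N) → ℝ}
    {S : ℝ} (hS : ∀ x, |f x| ≤ S) (hf : ∀ x, 1 < ‖x‖ → f x = 0) :
    |∫ x, f x| ≤ S * volume.real (closedBall (0 : EuclideanSpace ℝ (Fin N)) 1) := by
  rw [← setIntegral_eq_integral_of_forall_compl_eq_zero (s := closedBall 0 1) fun x hx => hf x (by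
    simpa using hx)]
  exact norm_setIntegral_le_of_norm_le_const measure_closedBall_lt_top fun x _ =>
    (Real.norm_eq_abs _).trans_le (hS x)

theorem hasCompactSupport_of_forall_norm_gt_one_eq_zero {N : ℕ}
    {f : EuclideanSpace ℝ (Fin N) → ℝ} (hf : ∀ x, 1 ≤ ‖x‖ → f x = 0) : HasCompactSupport f :=
  HasCompactSupport.of_support_subset_isCompact (isCompact_closedBall 0 1) fun x hx => by
    by_contra hcon
    simp only [mem_closedBall, dist_zero_right, not_le] at hcon
    exact hx (hf x hcon.le)

theorem exists_bound_on_closedBall {V F : Type*} [NormedAddCommGroup V] [ProperSpace V]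
    [NormedAddCommGroup F] {f : V → F} (hf : Continuous f) (R : ℝ) :
    ∃ D, 1 ≤ D ∧ ∀ w, ‖w‖ ≤ R → ‖f w‖ ≤ D := by
  obtain ⟨D, hD⟩ := (isCompact_closedBall (0 : V) R).exists_bound_of_continuousOn hf.continuousOn
  exact ⟨max 1 D, le_max_left _ _, fun w hw => (hD w (by simpa using hw)).trans (le_max_right _ _)⟩

namespace HeisenbergSpace

variable {n : ℕ}

theorem norm_coord_le (a : Fin n ⊕ Fin n ⊕ Unit) : ‖coord a‖ ≤ 1 :=
  ContinuousLinearMap.opNorm_le_bound _ zero_le_one fun p => by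
    rw [one_mul]
    exact abs_apply_le p a

variable {u : ℕ → EuclideanSpace ℝ (Fin (n + 1)) → HeisenbergSpace n}
  {M a : ℕ → ℝ} {R : ℝ}

/-- Regard the integrals as sequences modulo null sequences. They alternate in v, and their
contraction with the symplectic form equals, by parts, an integral with one contact slot, hence O(a
k * M k ^ n). The Lefschetz lemma in this quotient space gives the claim without writing the form as
a multiple of dα. -/
theorem tendsto_integral_mul_covDet (hu : ∀ k, ContDiff ℝ 1 (u k))
    (hM : ∀ k x, ‖fderiv ℝ (u k) x‖ ≤ M k)
    (ha : ∀ k x, ‖(contact (u k x)).comp (fderiv ℝ (u k) x)‖ ≤ a k)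
    (hlim : Tendsto (fun k => a k * M k ^ n) atTop (nhds 0)) (hR : ∀ k x, ‖u k x‖ ≤ R)
    {c : HeisenbergSpace n → ℝ} (hc : ContDiff ℝ 1 c) (hc0 : ∀ k x, 1 ≤ ‖x‖ → c (u k x) = 0)
    (v : Fin (n + 1) → Fin n ⊕ Fin n) :
    Tendsto (fun k => ∫ x, c (u k x) *
      covDet (n + 1) fun i => (coord (horIndex (v i))).comp (fderiv ℝ (u k) x)) atTop (nhds 0) := by
  let Z : Submodule ℝ (ℕ → ℝ) :=
    { carrier := {f | Tendsto f atTop (nhds 0)}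
      add_mem' := fun {f g} hf hg => by
        have h := Tendsto.add hf hg
        rwa [add_zero] at h
      zero_mem' := tendsto_const_nhds
      smul_mem' := fun r f hf => by
        have h := Tendsto.const_mul r hf
        rwa [mul_zero] at h }
  let I : (Fin (n + 1) → Fin n ⊕ Fin n) → ℕ → ℝ := fun v k => ∫ x, c (u k x) *
      covDet (n + 1) fun i => (coord (horIndex (v i))).comp (fderiv ℝ (u k) x)
  obtain ⟨D, hD1, hD⟩ := exists_bound_on_closedBall (hc.continuous_fderiv one_ne_zero) R
  have hM0 : ∀ k, 0 ≤ M k := fun k => (norm_nonneg _).trans (hM k 0)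
  have hcont : ∀ k j, Continuous fun x => (coord j).comp (fderiv ℝ (u k) x) := fun k j =>
    continuous_const.clm_comp ((hu k).continuous_fderiv one_ne_zero)
  have hcs : ∀ k, HasCompactSupport fun x => c (u k x) := fun k =>
    hasCompactSupport_of_forall_norm_gt_one_eq_zero (hc0 k)
  have hint : ∀ (v : Fin (n + 1) → Fin n ⊕ Fin n) k, Integrable fun x => c (u k x) *
      covDet (n + 1) fun i => (coord (horIndex (v i))).comp (fderiv ℝ (u k) x) := fun v k =>
    Continuous.integrable_of_hasCompactSupport
      ((hc.continuous.comp (hu k).continuous).mul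
        ((continuous_covDet _).comp (continuous_pi fun i => hcont k _))) (hcs k).mul_right
  suffices h : Z.mkQ (I v) = 0 by
    rw [Submodule.mkQ_apply, Submodule.Quotient.mk_eq_zero] at h
    exact h
  refine eq_zero_of_symplectic_contraction_eq_zero (by simp) (fun v => Z.mkQ (I v))
    ?_ ?_ ?_ v
  · intro v σ
    have : I (v ∘ σ) = Equiv.Perm.sign σ • I v := by
      funext k
      simp only [I, comp_apply, Pi.smul_apply]
      have h : ∀ x, covDet (n + 1)
            (fun i => (coord (horIndex (v (σ i)))).comp (fderiv ℝ (u k) x))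
          = Equiv.Perm.sign σ • covDet (n + 1)
            (fun i => (coord (horIndex (v i))).comp (fderiv ℝ (u k) x)) := fun x =>
        (covDet (n + 1)).map_perm
          (fun i => (coord (horIndex (v i))).comp (fderiv ℝ (u k) x)) σ
      simp only [h]
      rcases Int.units_eq_one_or (Equiv.Perm.sign σ) with hs | hs
      · simp only [hs, one_smul]
      · simp only [hs, Units.neg_smul, one_smul, mul_neg, integral_neg]
    rw [this, Units.smul_def, Units.smul_def, map_zsmul]
  · intro v hv
    have : I v = 0 := by
      funext k
      simp only [I, Pi.zero_apply]
      rw [← integral_zero (EuclideanSpace ℝ (Fin (n + 1))) ℝ]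
      refine integral_congr_ae (Eventually.of_forall fun x => ?_)
      have h := (covDet (n + 1)).map_eq_zero_of_not_injective
        (fun i => (coord (horIndex (v i))).comp (fderiv ℝ (u k) x)) (fun hinj => hv fun i j hij =>
          hinj (by simp only [hij]))
      simp only [h, mul_zero]
    rw [this, map_zero]
  · intro v s t hst
    rw [← map_sum, Submodule.mkQ_apply, Submodule.Quotient.mk_eq_zero]
    have hform : ∀ k, (∑ j, I (update (update v s (.inl j)) t (.inr j))) k
        = -(1 / 4) * ∫ x, covDetSlots (fun i => (coord (horIndex (v i))).comp (fderiv ℝ (u k) x))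
          s t (fderiv ℝ (fun x => c (u k x)) x) ((contact (u k x)).comp (fderiv ℝ (u k) x)) := by
      intro k
      rw [← integral_mul_sum_covDetSlots (c := fun x => c (u k x)) (hu k) (hc.comp (hu k)) (hcs k)
        (fun i => horIndex (v i)) hst, Finset.sum_apply, ← integral_finsetSum _ fun j _ => hint _ k]
      refine integral_congr_ae (Eventually.of_forall fun x => ?_)
      simp only [Finset.mul_sum]
      refine Finset.sum_congr rfl fun j _ => ?_
      rw [covDetSlots_apply]
      congr 2
      funext i
      by_cases h2 : i = t
      · subst h2; simp [horIndex]
      by_cases h1 : i = s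
      · subst h1; simp [hst, horIndex]
      · simp [h1, h2]
    have hbound : ∀ k, |(∑ j, I (update (update v s (.inl j)) t (.inr j))) k|
        ≤ (‖covDetCLM (n + 1)‖ * D ^ n
          * volume.real (closedBall (0 : EuclideanSpace ℝ (Fin (n + 1))) 1)) * (a k * M k ^ n) := by
      intro k
      have hpt : ∀ x, |covDetSlots (fun i => (coord (horIndex (v i))).comp (fderiv ℝ (u k) x))
          s t (fderiv ℝ (fun x => c (u k x)) x) ((contact (u k x)).comp (fderiv ℝ (u k) x))|
          -- Slot t holds the contact form; the other n slots hold dc or a coordinate differential,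
          -- both bounded by D * M k because 1 ≤ D.
          ≤ ‖covDetCLM (n + 1)‖ * (a k * (D * M k) ^ n) := by
        intro x
        rw [covDetSlots_apply]
        refine abs_covDet_le t (by simpa using ha k x) fun i hi => ?_
        rw [update_of_ne hi]
        by_cases h1 : i = s
        · subst h1
          rw [update_self]
          have hchain : fderiv ℝ (fun x => c (u k x)) x
              = (fderiv ℝ c (u k x)).comp (fderiv ℝ (u k) x) :=
            fderiv_comp x (hc.differentiable one_ne_zero _) ((hu k).differentiable one_ne_zero x)
          rw [hchain]
          exact (ContinuousLinearMap.opNorm_comp_le _ _).trans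
            (mul_le_mul (hD _ (hR k x)) (hM k x) (norm_nonneg _) (by linarith))
        · rw [update_of_ne h1]
          exact (ContinuousLinearMap.opNorm_comp_le _ _).trans
            (mul_le_mul ((norm_coord_le _).trans hD1) (hM k x) (norm_nonneg _) (by linarith))
      have hz : ∀ x, 1 < ‖x‖ → covDetSlots
          (fun i => (coord (horIndex (v i))).comp (fderiv ℝ (u k) x))
          s t (fderiv ℝ (fun x => c (u k x)) x) ((contact (u k x)).comp (fderiv ℝ (u k) x)) = 0 := by
        intro x hx
        have h0 : (fun x => c (u k x)) =ᶠ[nhds x] fun _ => 0 := by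
          have : {y : EuclideanSpace ℝ (Fin (n + 1)) | 1 < ‖y‖} ∈ nhds x :=
            (isOpen_lt continuous_const continuous_norm).mem_nhds hx
          filter_upwards [this] with y hy
          exact hc0 k y (le_of_lt hy)
        rw [h0.fderiv_eq, fderiv_fun_const, covDetSlots_apply]
        exact (covDet (n + 1)).map_coord_zero s (by simp [hst])
      have h := abs_integral_le_of_forall_norm_gt_one_eq_zero hpt hz
      rw [hform, abs_mul, abs_neg, abs_of_pos (by norm_num : (0 : ℝ) < 1 / 4)]
      rw [mul_pow] at h
      refine (mul_le_of_le_one_left (abs_nonneg _) (by norm_num)).trans (h.trans (le_of_eq ?_))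
      ring
    exact squeeze_zero_norm (a := fun k => _) hbound (by simpa using hlim.const_mul _)

/-- The horizontal left-invariant vector fields `Xⱼ` and `Yⱼ`. -/
noncomputable def horField (p : HeisenbergSpace n) : Fin n ⊕ Fin n → HeisenbergSpace n :=
  Sum.elim
    (fun j => EuclideanSpace.single (.inl j) 1
      + (2 * p (.inr (.inl j))) • EuclideanSpace.single (.inr (.inr ())) 1)
    (fun j => EuclideanSpace.single (.inr (.inl j)) 1
      - (2 * p (.inl j)) • EuclideanSpace.single (.inr (.inr ())) 1)

/-- The frame Xⱼ, Yⱼ, ∂ₜ is dual to dxⱼ, dyⱼ and the contact form. -/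
theorem eq_sum_horField_add (p w : HeisenbergSpace n) :
    w = ∑ i, w (horIndex i) • horField p i
      + contact p w • EuclideanSpace.single (.inr (.inr ())) (1 : ℝ) := by
  ext i
  rcases i with i | i | i
  · simp [horField, horIndex, Pi.single_apply]
  · simp [horField, horIndex, Pi.single_apply]
  · simp only [horField, horIndex, Fintype.sum_sum_type, contact_apply]
    simp [mul_comm, Finset.sum_sub_distrib]
    ring

theorem contDiff_horField (i : Fin n ⊕ Fin n) : ContDiff ℝ 1 fun p : HeisenbergSpace n =>
    horField p i := by
  have h : ∀ b : Fin n ⊕ Fin n ⊕ Unit, ContDiff ℝ 1 fun p : HeisenbergSpace n => p b := fun b =>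
    (coord b).contDiff
  rcases i with j | j
  · exact contDiff_const.add ((contDiff_const.mul (h _)).smul contDiff_const)
  · exact contDiff_const.sub ((contDiff_const.mul (h _)).smul contDiff_const)

theorem continuous_contact : Continuous (contact : HeisenbergSpace n → _) := by
  have h : ∀ b : Fin n ⊕ Fin n ⊕ Unit, Continuous fun p : HeisenbergSpace n => p b := fun b =>
    (coord b).continuous
  exact continuous_const.add (continuous_finsetSum _ fun j _ =>
    ((continuous_const.mul (h _)).smul continuous_const).sub
      ((continuous_const.mul (h _)).smul continuous_const))

end HeisenbergSpace

end Vanishing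

/-! ### Reduction of general (n+1)-forms to horizontal ones. -/

section Pullback

open MeasureTheory Metric Set Module Function Filter

namespace HeisenbergSpace

variable {n : ℕ} {u : ℕ → EuclideanSpace ℝ (Fin (n + 1)) → HeisenbergSpace n}
  {M a : ℕ → ℝ} {R : ℝ}

/-- The part of `l ∘ T` that does not involve the contact form at `p`. -/
noncomputable def horPart {N : ℕ} (p : HeisenbergSpace n) (l : HeisenbergSpace n →L[ℝ] ℝ)
    (T : EuclideanSpace ℝ (Fin N) →L[ℝ] HeisenbergSpace n) : EuclideanSpace ℝ (Fin N) →L[ℝ] ℝ :=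
  ∑ i, l (horField p i) • (coord (horIndex i)).comp T

theorem comp_sub_horPart {N : ℕ} (p : HeisenbergSpace n) (l : HeisenbergSpace n →L[ℝ] ℝ)
    (T : EuclideanSpace ℝ (Fin N) →L[ℝ] HeisenbergSpace n) :
    l.comp T - horPart p l T
      = l (EuclideanSpace.single (.inr (.inr ())) 1) • (contact p).comp T := by
  rw [sub_eq_iff_eq_add']
  ext e
  have h := congrArg l (eq_sum_horField_add p (T e))
  rw [map_add, map_sum] at h
  simp only [map_smul, smul_eq_mul] at h
  simp only [horPart, add_apply, sum_apply,
    smul_apply, ContinuousLinearMap.comp_apply, coord_apply, smul_eq_mul]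
  rw [h, mul_comm (contact p (T e))]
  congr 1
  exact Finset.sum_congr rfl fun i _ => mul_comm _ _

theorem covDet_horPart {N : ℕ} (p : HeisenbergSpace n) (l : Fin N → HeisenbergSpace n →L[ℝ] ℝ)
    (T : EuclideanSpace ℝ (Fin N) →L[ℝ] HeisenbergSpace n) :
    covDet N (fun i => horPart p (l i) T)
      = ∑ v : Fin N → Fin n ⊕ Fin n, (∏ i, l i (horField p (v i)))
        * covDet N fun i => (coord (horIndex (v i))).comp T := by
  have h := (covDet N).toMultilinearMap.map_sum
    (fun i (j : Fin n ⊕ Fin n) => l i (horField p j) • (coord (horIndex j)).comp T)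
  refine h.trans (Finset.sum_congr rfl fun v _ => ?_)
  exact (covDet N).toMultilinearMap.map_smul_univ _ _

/-- Multilinear telescoping: one slot holds a multiple of the contact pullback, at most D * α. The
others are at most D * m + D * C * m ≤ 2 * C * D * m. -/
theorem abs_covDet_comp_sub_le (p : HeisenbergSpace n) {D C m α : ℝ} (hD1 : 1 ≤ D) (hC1 : 1 ≤ C)
    {l : Fin (n + 1) → HeisenbergSpace n →L[ℝ] ℝ} (hl : ∀ i, ‖l i‖ ≤ D) (hC : ‖contact p‖ ≤ C)
    {T : EuclideanSpace ℝ (Fin (n + 1)) →L[ℝ] HeisenbergSpace n} (hT : ‖T‖ ≤ m)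
    (hα : ‖(contact p).comp T‖ ≤ α) :
    |covDet (n + 1) (fun i => (l i).comp T) - covDet (n + 1) (fun i => horPart p (l i) T)|
      ≤ ‖covDetCLM (n + 1)‖ * (n + 1) * (2 * C * D) ^ n * D * (α * m ^ n) := by
  have hm : 0 ≤ m := (norm_nonneg _).trans hT
  have hα0 : 0 ≤ α := (norm_nonneg _).trans hα
  have hv : ∀ i, ‖l i (EuclideanSpace.single (.inr (.inr ())) 1)‖ ≤ D := fun i => by
    refine ((l i).le_opNorm _).trans ?_
    simpa using hl i
  have h1 : ∀ i, ‖(l i).comp T‖ ≤ D * m := fun i =>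
    (ContinuousLinearMap.opNorm_comp_le _ _).trans
      (mul_le_mul (hl i) hT (norm_nonneg _) (by linarith))
  have h2 : ∀ i, ‖(l i).comp T - horPart p (l i) T‖ ≤ D * α := fun i => by
    rw [comp_sub_horPart, norm_smul]
    exact mul_le_mul (hv i) hα (norm_nonneg _) (by linarith)
  have h3 : ∀ i, ‖horPart p (l i) T‖ ≤ 2 * C * D * m := fun i => by
    have e1 : horPart p (l i) T = (l i).comp T - ((l i).comp T - horPart p (l i) T) := by abel
    have e2 : ‖(l i).comp T - horPart p (l i) T‖ ≤ D * (C * m) := by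
      rw [comp_sub_horPart, norm_smul]
      refine mul_le_mul (hv i) ?_ (norm_nonneg _) (by linarith)
      exact (ContinuousLinearMap.opNorm_comp_le _ _).trans
        (mul_le_mul hC hT (norm_nonneg _) (by linarith))
    rw [e1]
    refine (norm_sub_le _ _).trans ((add_le_add (h1 i) e2).trans ?_)
    have : D * m ≤ C * (D * m) := le_mul_of_one_le_left (by positivity) hC1
    linarith
  have h4 : ∀ i, ‖(l i).comp T‖ ≤ 2 * C * D * m := fun i => by
    refine (h1 i).trans ?_
    have : D * m ≤ C * (D * m) := le_mul_of_one_le_left (by positivity) hC1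
    have : 0 ≤ D * m := by positivity
    nlinarith
  refine ((covDetCLM (n + 1)).norm_image_sub_le _ _).trans ?_
  rw [Fintype.card_fin, Nat.add_sub_cancel, Nat.cast_add, Nat.cast_one]
  calc _ ≤ ‖covDetCLM (n + 1)‖ * (n + 1) * (2 * C * D * m) ^ n * (D * α) := by
        gcongr
        · refine max_le ?_ ?_
          · exact (pi_norm_le_iff_of_nonneg (by positivity)).2 h4
          · exact (pi_norm_le_iff_of_nonneg (by positivity)).2 h3
        · exact (pi_norm_le_iff_of_nonneg (by positivity)).2 h2
    _ = _ := by rw [mul_pow]; ring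

/-- Replacing each differential by its horizontal part costs O(a k * M k ^ n). What remains is a
finite sum of integrals covered by `tendsto_integral_mul_covDet`; G is taken C² so that the
coefficients, which contain its first derivatives, are C¹. -/
theorem tendsto_integral_prod_mul_covDet (hu : ∀ k, ContDiff ℝ 1 (u k))
    (hM : ∀ k x, ‖fderiv ℝ (u k) x‖ ≤ M k)
    (ha : ∀ k x, ‖(contact (u k x)).comp (fderiv ℝ (u k) x)‖ ≤ a k)
    (hlim : Tendsto (fun k => a k * M k ^ n) atTop (nhds 0)) (hR : ∀ k x, ‖u k x‖ ≤ R)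
    {G : Fin (n + 1) → HeisenbergSpace n → ℝ} (hG : ∀ i, ContDiff ℝ 2 (G i))
    {b : ℝ → ℝ} (hb : ContDiff ℝ 1 b)
    (hb0 : ∀ k x, 1 ≤ ‖x‖ → ∏ i, b (G i (u k x)) = 0) :
    Tendsto (fun k => ∫ x, (∏ i, b (G i (u k x))) *
      covDet (n + 1) fun i => fderiv ℝ (fun y => G i (u k y)) x) atTop (nhds 0) := by
  have hG1 : ∀ i, ContDiff ℝ 1 (G i) := fun i => (hG i).of_le (by norm_num)
  have hdG : ∀ i, ContDiff ℝ 1 (fderiv ℝ (G i)) := fun i =>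
    (hG i).fderiv_right (by norm_num)
  have hψ : ContDiff ℝ 1 fun w => ∏ i, b (G i w) :=
    contDiff_prod fun i _ => hb.comp (hG1 i)
  obtain ⟨S, hS1, hS⟩ := exists_bound_on_closedBall hψ.continuous R
  have hDi : ∀ i, ∃ D, 1 ≤ D ∧ ∀ w, ‖w‖ ≤ R → ‖fderiv ℝ (G i) w‖ ≤ D := fun i =>
    exists_bound_on_closedBall (hdG i).continuous R
  obtain ⟨D, hD1, hD⟩ : ∃ D, 1 ≤ D ∧ ∀ i w, ‖w‖ ≤ R → ‖fderiv ℝ (G i) w‖ ≤ D := by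
    choose D hD1 hD using hDi
    refine ⟨∑ i, D i, ?_, fun i w hw => (hD i w hw).trans ?_⟩
    · exact (hD1 0).trans (Finset.single_le_sum (fun i _ => zero_le_one.trans (hD1 i))
        (Finset.mem_univ 0))
    · exact Finset.single_le_sum (fun i _ => zero_le_one.trans (hD1 i)) (Finset.mem_univ i)
  obtain ⟨C, hC1, hC⟩ := exists_bound_on_closedBall (continuous_contact (n := n)) R
  have hchain : ∀ k i x, fderiv ℝ (fun y => G i (u k y)) x
      = (fderiv ℝ (G i) (u k x)).comp (fderiv ℝ (u k) x) := fun k i x =>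
    fderiv_comp x ((hG1 i).differentiable one_ne_zero _) ((hu k).differentiable one_ne_zero x)
  have hDu : ∀ k, Continuous (fderiv ℝ (u k)) := fun k => (hu k).continuous_fderiv one_ne_zero
  have hψu : ∀ k, Continuous fun x => ∏ i, b (G i (u k x)) := fun k =>
    hψ.continuous.comp (hu k).continuous
  have hψs : ∀ k, HasCompactSupport fun x => ∏ i, b (G i (u k x)) := fun k =>
    hasCompactSupport_of_forall_norm_gt_one_eq_zero (hb0 k)
  have hcv : ∀ v : Fin (n + 1) → Fin n ⊕ Fin n, ContDiff ℝ 1 fun w =>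
      (∏ i, b (G i w)) * ∏ i, fderiv ℝ (G i) w (horField w (v i)) := fun v =>
    hψ.mul (contDiff_prod fun i _ => (hdG i).clm_apply (contDiff_horField (v i)))
  have hintv : ∀ k (v : Fin (n + 1) → Fin n ⊕ Fin n), Integrable fun x =>
      ((∏ i, b (G i (u k x))) * ∏ i, fderiv ℝ (G i) (u k x) (horField (u k x) (v i)))
        * covDet (n + 1) fun i => (coord (horIndex (v i))).comp (fderiv ℝ (u k) x) := fun k v =>
    Continuous.integrable_of_hasCompactSupport
      (((hcv v).continuous.comp (hu k).continuous).mul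
        ((continuous_covDet _).comp (continuous_pi fun i => continuous_const.clm_comp (hDu k))))
      (hψs k).mul_right.mul_right
  have hhor : ∀ k x, (∏ i, b (G i (u k x))) * covDet (n + 1) (fun i =>
        horPart (u k x) (fderiv ℝ (G i) (u k x)) (fderiv ℝ (u k) x))
      = ∑ v : Fin (n + 1) → Fin n ⊕ Fin n,
        ((∏ i, b (G i (u k x))) * ∏ i, fderiv ℝ (G i) (u k x) (horField (u k x) (v i)))
        * covDet (n + 1) fun i => (coord (horIndex (v i))).comp (fderiv ℝ (u k) x) := by
    intro k x
    rw [covDet_horPart, Finset.mul_sum]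
    exact Finset.sum_congr rfl fun v _ => by rw [mul_assoc]
  have hlimhor : Tendsto (fun k => ∫ x, (∏ i, b (G i (u k x))) * covDet (n + 1) (fun i =>
        horPart (u k x) (fderiv ℝ (G i) (u k x)) (fderiv ℝ (u k) x))) atTop (nhds 0) := by
    simp only [hhor]
    simp only [fun k => integral_finsetSum Finset.univ fun v _ => hintv k v]
    rw [← Finset.sum_const_zero (s := (Finset.univ : Finset (Fin (n + 1) → Fin n ⊕ Fin n)))]
    exact tendsto_finsetSum _ fun v _ => tendsto_integral_mul_covDet hu hM ha hlim hR (hcv v)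
      (fun k x hx => by rw [hb0 k x hx, zero_mul]) v
  have hi1 : ∀ k, Integrable fun x => (∏ i, b (G i (u k x))) *
      covDet (n + 1) fun i => fderiv ℝ (fun y => G i (u k y)) x := fun k =>
    ((hψu k).mul (continuous_covDet_fderiv fun i =>
      (hG1 i).comp (hu k))).integrable_of_hasCompactSupport (hψs k).mul_right
  have hi2 : ∀ k, Integrable fun x => (∏ i, b (G i (u k x))) * covDet (n + 1) (fun i =>
      horPart (u k x) (fderiv ℝ (G i) (u k x)) (fderiv ℝ (u k) x)) := fun k => by
    simp only [hhor]
    exact integrable_finsetSum _ fun v _ => hintv k v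
  have hbound : ∀ k, ‖(∫ x, (∏ i, b (G i (u k x))) *
        covDet (n + 1) fun i => fderiv ℝ (fun y => G i (u k y)) x)
      - ∫ x, (∏ i, b (G i (u k x))) * covDet (n + 1) (fun i =>
        horPart (u k x) (fderiv ℝ (G i) (u k x)) (fderiv ℝ (u k) x))‖
      ≤ S * (‖covDetCLM (n + 1)‖ * (n + 1) * (2 * C * D) ^ n * D)
        * volume.real (closedBall (0 : EuclideanSpace ℝ (Fin (n + 1))) 1) * (a k * M k ^ n) := by
    intro k
    rw [Real.norm_eq_abs, ← integral_sub (hi1 k) (hi2 k)]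
    refine (abs_integral_le_of_forall_norm_gt_one_eq_zero (S := S * (‖covDetCLM (n + 1)‖ * (n + 1)
      * (2 * C * D) ^ n * D * (a k * M k ^ n))) (fun x => ?_) fun x hx => ?_).trans
      (le_of_eq (by ring))
    · rw [← mul_sub, abs_mul]
      refine mul_le_mul (hS _ (hR k x)) ?_ (abs_nonneg _) (by linarith)
      simp only [hchain]
      exact abs_covDet_comp_sub_le (u k x) hD1 hC1 (fun i => hD i _ (hR k x)) (hC _ (hR k x))
        (hM k x) (ha k x)
    · rw [hb0 k x hx.le, zero_mul, zero_mul, sub_zero]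
  have hz := hlim.const_mul (S * (‖covDetCLM (n + 1)‖ * (n + 1) * (2 * C * D) ^ n * D)
    * volume.real (closedBall (0 : EuclideanSpace ℝ (Fin (n + 1))) 1))
  rw [mul_zero] at hz
  have h0 := squeeze_zero_norm hbound hz
  simpa using h0.add hlimhor

end HeisenbergSpace

end Pullback

/-! ### Hölder moduli, retraction, approximate inverse and rescaled mollification. -/

section Approximation

open MeasureTheory Metric Set Module Function Filter

theorem HolderClass.exists_dist_le {X Y : Type*} [MetricSpace X] [MetricSpace Y] {α : ℝ≥0}
    {f : X → Y} {s : Set X} (h : HolderClass α f s) :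
    ∃ C : ℝ, 0 ≤ C ∧ ∀ x ∈ s, ∀ y ∈ s, dist (f x) (f y) ≤ C * dist x y ^ (α : ℝ) := by
  obtain ⟨C, hC⟩ := h
  exact ⟨C, C.2, fun x hx y hy => hC.dist_le hx hy⟩

theorem HolderPlusClass.exists_dist_le {X Y : Type*} [MetricSpace X] [MetricSpace Y] {α : ℝ≥0}
    {f : X → Y} {s : Set X} (h : HolderPlusClass α f s) {c : ℝ} (hc : 0 < c) :
    ∃ t : ℝ, 0 < t ∧ ∀ x ∈ s, ∀ y ∈ s, dist x y ≤ t →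
      dist (f x) (f y) ≤ c * dist x y ^ (α : ℝ) := by
  have hev := h.eventually (gt_mem_nhds (ENNReal.ofReal_pos.2 hc))
  obtain ⟨t, ht, ht0⟩ := (hev.and self_mem_nhdsWithin).exists
  refine ⟨t, ht0, fun x hx y hy hxy => ?_⟩
  rcases eq_or_ne x y with rfl | hne
  · rw [dist_self]
    positivity
  have hd : 0 < dist x y := dist_pos.2 hne
  have h1 : edist (f x) (f y) / edist x y ^ (α : ℝ) ≤ holderModulus α f s t := by
    unfold holderModulus
    exact le_iSup_of_le x (le_iSup_of_le hx (le_iSup_of_le y (le_iSup_of_le hy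
      (le_iSup_of_le ⟨hd, hxy⟩ le_rfl))))
  have h2 := h1.trans ht.le
  rw [edist_dist, edist_dist, ENNReal.ofReal_rpow_of_pos hd,
    ← ENNReal.ofReal_div_of_pos (Real.rpow_pos_of_pos hd _),
    ENNReal.ofReal_le_ofReal_iff hc.le, div_le_iff₀ (Real.rpow_pos_of_pos hd _)] at h2
  exact h2

/-- The radial retraction onto the closed unit ball. -/
noncomputable def ballRetraction {V : Type*} [NormedAddCommGroup V] [NormedSpace ℝ V] (x : V) : V :=
  (max 1 ‖x‖)⁻¹ • x

section ballRetraction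

variable {V : Type*} [NormedAddCommGroup V] [NormedSpace ℝ V]

theorem norm_ballRetraction_le (x : V) : ‖ballRetraction x‖ ≤ 1 := by
  have h : 0 < max 1 ‖x‖ := lt_max_of_lt_left one_pos
  rw [ballRetraction, norm_smul, norm_inv, Real.norm_of_nonneg h.le, inv_mul_le_iff₀ h, mul_one]
  exact le_max_right _ _

theorem ballRetraction_of_one_le {x : V} (hx : 1 ≤ ‖x‖) : ballRetraction x = ‖x‖⁻¹ • x := by
  rw [ballRetraction, max_eq_right hx]

theorem ballRetraction_of_le_one {x : V} (hx : ‖x‖ ≤ 1) : ballRetraction x = x := by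
  rw [ballRetraction, max_eq_left hx, inv_one, one_smul]

theorem dist_ballRetraction_le (x y : V) :
    dist (ballRetraction x) (ballRetraction y) ≤ 2 * dist x y := by
  set a := max 1 ‖x‖ with ha
  set b := max 1 ‖y‖ with hb
  have ha1 : 1 ≤ a := le_max_left _ _
  have hb1 : 1 ≤ b := le_max_left _ _
  have ha0 : a ≠ 0 := by positivity
  have hb0 : b ≠ 0 := by positivity
  have hdec : ballRetraction x - ballRetraction y = a⁻¹ • (x - y) + (a⁻¹ * (b - a)) • (b⁻¹ • y) := by
    have h : (a⁻¹ * (b - a)) • (b⁻¹ • y) = a⁻¹ • y - b⁻¹ • y := by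
      rw [smul_smul, ← sub_smul]
      congr 1
      field_simp
    rw [h, smul_sub, ballRetraction, ballRetraction]
    abel
  have hab : |b - a| ≤ ‖x - y‖ := by
    rw [abs_sub_comm, ha, hb, max_comm 1, max_comm 1]
    exact (abs_max_sub_max_le_abs _ _ _).trans (abs_norm_sub_norm_le x y)
  have hai : a⁻¹ ≤ 1 := inv_le_one_of_one_le₀ ha1
  have hy : ‖b⁻¹ • y‖ ≤ 1 := norm_ballRetraction_le y
  rw [dist_eq_norm, dist_eq_norm, hdec]
  refine (norm_add_le _ _).trans ?_
  rw [norm_smul, norm_smul, norm_mul, Real.norm_of_nonneg (by positivity : 0 ≤ a⁻¹),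
    Real.norm_eq_abs]
  have h1 : a⁻¹ * ‖x - y‖ ≤ 1 * ‖x - y‖ := by gcongr
  have h2 : a⁻¹ * |b - a| * ‖b⁻¹ • y‖ ≤ 1 * ‖x - y‖ * 1 := by gcongr
  linarith

end ballRetraction

theorem exists_linearIsometry_euclideanSpace {k m : ℕ} (h : k ≤ m) :
    Nonempty (EuclideanSpace ℝ (Fin k) →ₗᵢ[ℝ] EuclideanSpace ℝ (Fin m)) := by
  let b := (EuclideanSpace.basisFun (Fin k) ℝ).toBasis
  let w : Fin k → EuclideanSpace ℝ (Fin m) := fun j =>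
    EuclideanSpace.basisFun (Fin m) ℝ (Fin.castLE h j)
  have hb : Orthonormal ℝ b := by simp [b]
  have hw : Orthonormal ℝ w :=
    (EuclideanSpace.basisFun (Fin m) ℝ).orthonormal.comp _ (Fin.castLE_injective h)
  refine ⟨(b.constr ℝ w).isometryOfOrthonormal (v := b) hb ?_⟩
  have : b.constr ℝ w ∘ b = w := funext fun j => b.constr_basis ℝ w j
  rwa [this]

/-- Stone–Weierstrass for the algebra of functions G ∘ φ with G of class C²; coordinates separate
points because φ is injective. -/
theorem exists_contDiff_near_continuousMap {X ι : Type*} [TopologicalSpace X] [CompactSpace X]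
    [Fintype ι] {φ : X → EuclideanSpace ℝ ι} (hφ : Continuous φ) (hinj : Injective φ)
    (h : C(X, ℝ)) {ε : ℝ} (hε : 0 < ε) :
    ∃ G : EuclideanSpace ℝ ι → ℝ, ContDiff ℝ 2 G ∧ ∀ x, |G (φ x) - h x| ≤ ε := by
  let A : Subalgebra ℝ C(X, ℝ) :=
    { carrier := {f | ∃ G : EuclideanSpace ℝ ι → ℝ, ContDiff ℝ 2 G ∧ ∀ x, f x = G (φ x)}
      mul_mem' := fun {f g} ⟨F, hF, hf⟩ ⟨G, hG, hg⟩ =>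
        ⟨fun w => F w * G w, hF.mul hG, fun x => by simp [hf, hg]⟩
      add_mem' := fun {f g} ⟨F, hF, hf⟩ ⟨G, hG, hg⟩ =>
        ⟨fun w => F w + G w, hF.add hG, fun x => by simp [hf, hg]⟩
      algebraMap_mem' := fun r => ⟨fun _ => r, contDiff_const, fun x => rfl⟩ }
  have hA : A.SeparatesPoints := by
    intro x y hxy
    obtain ⟨i, hi⟩ : ∃ i, φ x i ≠ φ y i := by
      by_contra hcon
      push Not at hcon
      exact hxy (hinj (by ext i; exact hcon i))
    have hpi : ContDiff ℝ 2 fun w : EuclideanSpace ℝ ι => w i :=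
      (EuclideanSpace.proj i : EuclideanSpace ℝ ι →L[ℝ] ℝ).contDiff
    exact ⟨fun x => φ x i, ⟨⟨fun x => φ x i, hpi.continuous.comp hφ⟩,
      ⟨fun w => w i, hpi, fun x => rfl⟩, rfl⟩, hi⟩
  obtain ⟨⟨g, G, hG, hg⟩, hgh⟩ :=
    ContinuousMap.exists_mem_subalgebra_near_continuousMap_of_separatesPoints A hA h ε hε
  refine ⟨G, hG, fun x => ?_⟩
  rw [← hg x]
  exact ((g - h).norm_coe_le_norm x).trans hgh.le

theorem exists_contDiff_leftInverse_approx {ι : Type*} [Fintype ι] {N : ℕ}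
    {φ : EuclideanSpace ℝ (Fin N) → EuclideanSpace ℝ ι}
    (hφ : ContinuousOn φ (sphere 0 1)) (hinj : InjOn φ (sphere 0 1)) :
    ∃ G : Fin N → EuclideanSpace ℝ ι → ℝ, (∀ i, ContDiff ℝ 2 (G i)) ∧
      ∀ x ∈ sphere (0 : EuclideanSpace ℝ (Fin N)) 1,
        ‖WithLp.toLp 2 (fun i => G i (φ x)) - x‖ ≤ 1 / 4 := by
  -- This tolerance in each of the N coordinates gives Euclidean error at most 1/4.
  have hN : (0 : ℝ) < 1 / (4 * (N + 1)) := by positivity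
  have hcoord : ∀ i, ContinuousOn (fun x : EuclideanSpace ℝ (Fin N) => x i) (sphere 0 1) := fun i =>
    (EuclideanSpace.proj i : EuclideanSpace ℝ (Fin N) →L[ℝ] ℝ).continuous.continuousOn
  choose G hG hGx using fun i => exists_contDiff_near_continuousMap
    (φ := fun x : sphere (0 : EuclideanSpace ℝ (Fin N)) 1 => φ x)
    hφ.domRestrict (fun x y hxy => Subtype.ext (hinj x.2 y.2 hxy))
    ⟨fun x : sphere (0 : EuclideanSpace ℝ (Fin N)) 1 => x.1 i, (hcoord i).domRestrict⟩ hN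
  refine ⟨G, hG, fun x hx => ?_⟩
  refine le_of_sq_le_sq ?_ (by norm_num)
  rw [EuclideanSpace.norm_sq_eq]
  refine (Finset.sum_le_sum (g := fun _ => (1 / (4 * ((N : ℝ) + 1))) ^ 2) fun i _ => ?_).trans ?_
  · exact pow_le_pow_left₀ (norm_nonneg _) (hGx i ⟨x, hx⟩) 2
  · rw [Finset.sum_const, Finset.card_univ, Fintype.card_fin, nsmul_eq_mul, div_pow, one_pow,
      mul_one_div, div_le_iff₀ (by positivity)]
    nlinarith [Nat.cast_nonneg (α := ℝ) N]

namespace HeisenbergSpace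

/-- Mollify z ↦ F (r z) at unit scale and scale back. The n + 1 derivatives in a * M ^ n cost
r^-(n+1), which r^(2γ + nθ) cancels exactly, leaving C ^ (n + 1) * C₁ ^ 2 * C₂ ^ n. -/
theorem exists_smooth_approximation {n N : ℕ} {γ θ : ℝ} (hθ : 0 < θ)
    (hγθ : 2 * γ + n * θ = n + 1) (F : EuclideanSpace ℝ (Fin N) → Heisenberg n)
    (hF : Continuous fun z => (F z).toEuclidean)
    (hmod : ∀ c : ℝ, 0 < c → ∃ C₁ C₂ t : ℝ, 0 ≤ C₁ ∧ 0 ≤ C₂ ∧ 0 < t ∧ C₁ ^ 2 * C₂ ^ n ≤ c ∧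
      ∀ r, r ≤ t → ∀ p q, dist p q ≤ r → dist (F p) (F q) ≤ C₁ * r ^ γ ∧
        dist (F p).toEuclidean (F q).toEuclidean ≤ C₂ * r ^ θ)
    {c : ℝ} (hc : 0 < c) :
    ∃ (v : EuclideanSpace ℝ (Fin N) → HeisenbergSpace n) (a M : ℝ), ContDiff ℝ 1 v ∧
      0 ≤ a ∧ 0 ≤ M ∧ a * M ^ n ≤ c ∧ ∀ x, ‖v x - (F x).toEuclidean‖ ≤ c ∧
        ‖fderiv ℝ v x‖ ≤ M ∧ ‖(contact (v x)).comp (fderiv ℝ v x)‖ ≤ a := by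
  obtain ⟨C, hC0, hmol⟩ := exists_mollification N n
  obtain ⟨C₁, C₂, t, h1, h2, ht, h12, hmod⟩ := hmod (c / (C ^ (n + 1) + 1)) (by positivity)
  have hlim : Tendsto (fun r : ℝ => C₂ * r ^ θ) (nhdsWithin 0 (Ioi 0)) (nhds 0) := by
    have h := ((Real.continuousAt_rpow_const 0 θ (.inr hθ.le)).tendsto.const_mul C₂)
    rw [Real.zero_rpow hθ.ne', mul_zero] at h
    exact h.mono_left nhdsWithin_le_nhds
  obtain ⟨r, ⟨hrc, hrt⟩, hr⟩ := ((hlim.eventually (gt_mem_nhds hc)).and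
    (nhdsWithin_le_nhds (gt_mem_nhds ht)) |>.and self_mem_nhdsWithin).exists
  have hr0 : (0 : ℝ) < r := hr
  have hdist : ∀ p q : EuclideanSpace ℝ (Fin N), dist p q ≤ 1 → dist (r • p) (r • q) ≤ r := by
    intro p q hpq
    rw [dist_smul₀, Real.norm_of_nonneg hr0.le]
    exact mul_le_of_le_one_right hr0.le hpq
  obtain ⟨w, hw, hwest⟩ := hmol (fun z => F (r • z)) (C₁ * r ^ γ) (C₂ * r ^ θ) (by positivity)
    (by positivity) (hF.comp (continuous_const_smul r))
    (fun p q hpq => (hmod r hrt.le _ _ (hdist p q hpq)).1)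
    (fun p q hpq => (hmod r hrt.le _ _ (hdist p q hpq)).2)
  have hfd : ∀ x, fderiv ℝ (fun x => w (r⁻¹ • x)) x = r⁻¹ • fderiv ℝ w (r⁻¹ • x) := fun x =>
    fderiv_comp_smul r⁻¹
  refine ⟨fun x => w (r⁻¹ • x), r⁻¹ * (C * (C₁ * r ^ γ) ^ 2), r⁻¹ * (C * (C₂ * r ^ θ)),
    hw.comp (contDiff_const_smul _), by positivity, by positivity, ?_, fun x => ?_⟩
  · have hpow : (r ^ γ) ^ 2 * (r ^ θ) ^ n = r ^ (n + 1) := by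
      rw [← Real.rpow_natCast, ← Real.rpow_natCast, ← Real.rpow_natCast, ← Real.rpow_mul hr0.le,
        ← Real.rpow_mul hr0.le, ← Real.rpow_add hr0]
      congr 1
      push_cast
      linarith
    calc _ = (C ^ (n + 1) * (C₁ ^ 2 * C₂ ^ n)) * ((r⁻¹) ^ (n + 1) * ((r ^ γ) ^ 2 * (r ^ θ) ^ n)) := by
          ring
      _ = C ^ (n + 1) * (C₁ ^ 2 * C₂ ^ n) := by
          rw [hpow, ← mul_pow, inv_mul_cancel₀ hr0.ne', one_pow, mul_one]
      _ ≤ C ^ (n + 1) * (c / (C ^ (n + 1) + 1)) := by gcongr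
      _ ≤ c := by
          rw [mul_div_assoc', div_le_iff₀ (by positivity)]
          nlinarith
  · obtain ⟨e1, e2, e3⟩ := hwest (r⁻¹ • x)
    rw [smul_inv_smul₀ hr0.ne'] at e1
    refine ⟨e1.trans hrc.le, ?_, ?_⟩
    · rw [hfd, norm_smul, Real.norm_of_nonneg (by positivity)]
      gcongr
    · rw [hfd, ContinuousLinearMap.comp_smul, norm_smul, Real.norm_of_nonneg (by positivity)]
      gcongr

end HeisenbergSpace

end Approximation

/-! ### The contradiction, and reduction of the theorem to it. -/

section Nonembedding

open MeasureTheory Metric Set Module Function Filter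

namespace HeisenbergSpace

theorem not_injOn_sphere {n : ℕ} {γ θ : ℝ} (hθ : 0 < θ) (hγθ : 2 * γ + n * θ = n + 1)
    {F : EuclideanSpace ℝ (Fin (n + 1)) → Heisenberg n}
    (hF : Continuous fun z => (F z).toEuclidean)
    (hret : ∀ x, 1 ≤ ‖x‖ → F x = F (‖x‖⁻¹ • x)) {R : ℝ} (hR : ∀ x, ‖(F x).toEuclidean‖ ≤ R)
    (hmod : ∀ c : ℝ, 0 < c → ∃ C₁ C₂ t : ℝ, 0 ≤ C₁ ∧ 0 ≤ C₂ ∧ 0 < t ∧ C₁ ^ 2 * C₂ ^ n ≤ c ∧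
      ∀ r, r ≤ t → ∀ p q, dist p q ≤ r → dist (F p) (F q) ≤ C₁ * r ^ γ ∧
        dist (F p).toEuclidean (F q).toEuclidean ≤ C₂ * r ^ θ) :
    ¬ InjOn (fun z => (F z).toEuclidean) (sphere 0 1) := by
  intro hinj
  obtain ⟨G, hG, hGx⟩ := exists_contDiff_leftInverse_approx hF.continuousOn hinj
  obtain ⟨b, hb, hbs, hbi⟩ := exists_bump_prod (n + 1)
  set g : HeisenbergSpace n → EuclideanSpace ℝ (Fin (n + 1)) :=
    fun w => WithLp.toLp 2 fun i => G i w with hg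
  have hg1 : ContDiff ℝ 1 g := by
    rw [contDiff_euclidean]
    exact fun i => (hG i).of_le (by norm_num)
  obtain ⟨κ, hκ, hunif⟩ := Metric.uniformContinuousOn_iff.1
    ((isCompact_closedBall (0 : HeisenbergSpace n) (R + 1)).uniformContinuousOn_of_continuous
      hg1.continuous.continuousOn) (1 / 4) (by norm_num)
  -- κ/2 brings G(u k) within 1/4 of G(F), 1 keeps u k in the ball of radius R + 1, and 1/(k+1)
  -- makes a k * M k ^ n tend to 0.
  have hc : ∀ k : ℕ, 0 < min (min (κ / 2) 1) (1 / ((k : ℝ) + 1)) := fun k => by positivity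
  choose u a M hu ha0 hM0 haM hest using fun k => exists_smooth_approximation hθ hγθ F hF hmod (hc k)
  have hclose : ∀ k x, ‖u k x - (F x).toEuclidean‖ ≤ min (κ / 2) 1 := fun k x =>
    (hest k x).1.trans (min_le_left _ _)
  have huR : ∀ k x, ‖u k x‖ ≤ R + 1 := fun k x => by
    have h1 := norm_le_norm_add_norm_sub' (u k x) (F x).toEuclidean
    have h2 := (hclose k x).trans (min_le_right _ _)
    linarith [hR x]
  have hlim : Tendsto (fun k => a k * M k ^ n) atTop (nhds 0) :=
    squeeze_zero (fun k => mul_nonneg (ha0 k) (pow_nonneg (hM0 k) n))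
      (fun k => (haM k).trans (min_le_right _ _)) tendsto_one_div_add_atTop_nhds_zero_nat
  have hbd : ∀ k x, 1 ≤ ‖x‖ → ‖g (u k x) - ‖x‖⁻¹ • x‖ ≤ 1 / 2 := by
    intro k x hx
    have h1 : dist (g (u k x)) (g (F x).toEuclidean) < 1 / 4 := by
      refine hunif _ (by simpa using huR k x) _ (by simpa using (hR x).trans (by linarith)) ?_
      rw [dist_eq_norm]
      exact ((hclose k x).trans (min_le_left _ _)).trans_lt (by linarith)
    have hs : ‖x‖⁻¹ • x ∈ sphere (0 : EuclideanSpace ℝ (Fin (n + 1))) 1 := by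
      rw [mem_sphere_zero_iff_norm, norm_smul, norm_inv, norm_norm,
        inv_mul_cancel₀ (by positivity)]
    have h2 : ‖g (F x).toEuclidean - ‖x‖⁻¹ • x‖ ≤ 1 / 4 := by
      rw [hret x hx]
      exact hGx _ hs
    rw [dist_eq_norm] at h1
    have h3 := norm_sub_le_norm_sub_add_norm_sub (g (u k x)) (g (F x).toEuclidean) (‖x‖⁻¹ • x)
    linarith
  have hdeg : ∀ k, ∫ x, (∏ i, b (G i (u k x))) *
      covDet (n + 1) (fun i => fderiv ℝ (fun y => G i (u k y)) x)
      = ∫ x : EuclideanSpace ℝ (Fin (n + 1)), ∏ i, b (x i) := fun k =>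
    integral_prod_mul_covDet_eq (hg1.comp (hu k)) (hbd k) hb.continuous hbs
  have hb0 : ∀ k x, 1 ≤ ‖x‖ → ∏ i, b (G i (u k x)) = 0 := by
    intro k x hx
    by_contra hne
    have h := half_le_norm_interpolation hx (hbd k x hx) zero_le_one le_rfl
    rw [sub_self, zero_smul, add_zero, one_smul] at h
    exact absurd (hbs (g (u k x)) hne) (not_lt.2 h)
  have hzero := tendsto_integral_prod_mul_covDet hu (fun k x => (hest k x).2.1)
    (fun k x => (hest k x).2.2) hlim huR hG hb hb0
  simp only [hdeg] at hzero
  exact hbi.ne' (tendsto_nhds_unique tendsto_const_nhds hzero)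

end HeisenbergSpace

theorem Heisenberg.toEuclidean_injective {n : ℕ} :
    Injective (Heisenberg.toEuclidean : Heisenberg n → _) := by
  intro p q h
  have hi : ∀ i, p.toEuclidean i = q.toEuclidean i := fun i => by rw [h]
  ext j
  · exact hi (.inl j)
  · exact hi (.inr (.inl j))
  · exact hi (.inr (.inr ()))

/-- Both alternatives are used only through the product C₁² C₂ⁿ: the "+" factor can be made small
while the other constant stays fixed. Smallness of C₂ helps only because n ≠ 0. -/
theorem exists_holder_moduli {X Y Z : Type*} [MetricSpace X] [MetricSpace Y] [MetricSpace Z]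
    {γ θ : ℝ≥0} {f : X → Y} {g : X → Z} {s : Set X} {n : ℕ} (hn : n ≠ 0)
    (h : (HolderPlusClass γ f s ∧ HolderClass θ g s) ∨ (HolderClass γ f s ∧ HolderPlusClass θ g s))
    {c : ℝ} (hc : 0 < c) :
    ∃ C₁ C₂ t : ℝ, 0 ≤ C₁ ∧ 0 ≤ C₂ ∧ 0 < t ∧ C₁ ^ 2 * C₂ ^ n ≤ c ∧
      ∀ x ∈ s, ∀ y ∈ s, dist x y ≤ t → dist (f x) (f y) ≤ C₁ * dist x y ^ (γ : ℝ) ∧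
        dist (g x) (g y) ≤ C₂ * dist x y ^ (θ : ℝ) := by
  have small : ∀ (A : ℝ) (k : ℕ), k ≠ 0 → ∃ e : ℝ, 0 < e ∧ A * e ^ k ≤ c := by
    intro A k hk
    have hlim : Tendsto (fun e : ℝ => A * e ^ k) (nhdsWithin 0 (Ioi 0)) (nhds 0) := by
      have h : Tendsto (fun e : ℝ => A * e ^ k) (nhds 0) (nhds (A * 0 ^ k)) :=
        (continuous_const.mul (continuous_pow k)).tendsto 0
      rw [zero_pow hk, mul_zero] at h
      exact h.mono_left nhdsWithin_le_nhds
    obtain ⟨e, he, he0⟩ := ((hlim.eventually (gt_mem_nhds hc)).and self_mem_nhdsWithin).exists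
    exact ⟨e, he0, he.le⟩
  rcases h with ⟨hf, hg⟩ | ⟨hf, hg⟩
  · obtain ⟨C₂, hC₂, hg⟩ := hg.exists_dist_le
    obtain ⟨e, he, hec⟩ := small (C₂ ^ n) 2 two_ne_zero
    obtain ⟨t, ht, hf⟩ := hf.exists_dist_le he
    exact ⟨e, C₂, t, he.le, hC₂, ht, by rwa [mul_comm],
      fun x hx y hy hxy => ⟨hf x hx y hy hxy, hg x hx y hy⟩⟩
  · obtain ⟨C₁, hC₁, hf⟩ := hf.exists_dist_le
    obtain ⟨e, he, hec⟩ := small (C₁ ^ 2) n hn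
    obtain ⟨t, ht, hg⟩ := hg.exists_dist_le he
    exact ⟨C₁, e, t, hC₁, he.le, ht, hec,
      fun x hx y hy hxy => ⟨hf x hx y hy, hg x hx y hy hxy⟩⟩

theorem theorem2 (n m : ℕ) (hn : 1 ≤ n) (hm : n + 1 ≤ m) (γ θ : ℝ≥0)
    (hγ₁ : (1 / 2 : ℝ) ≤ γ) (hγ₂ : (γ : ℝ) ≤ ((n : ℝ) + 1) / ((n : ℝ) + 2))
    (hθ : (θ : ℝ) = ((n : ℝ) + 1) / n - 2 * γ / n) :
    ¬ ∃ f : EuclideanSpace ℝ (Fin m) → Heisenberg n,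
      ((HolderPlusClass γ f (Metric.closedBall 0 1) ∧
          HolderClass θ (fun z => (f z).toEuclidean) (Metric.closedBall 0 1)) ∨
        (HolderClass γ f (Metric.closedBall 0 1) ∧
          HolderPlusClass θ (fun z => (f z).toEuclidean) (Metric.closedBall 0 1))) ∧
      Topology.IsEmbedding ((Metric.sphere (0 : EuclideanSpace ℝ (Fin m)) 1).domRestrict f) := by
  rintro ⟨f, hf, hemb⟩
  have hn0 : (0 : ℝ) < n := by exact_mod_cast hn
  have hγθ : 2 * (γ : ℝ) + n * θ = n + 1 := by
    rw [hθ]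
    field_simp
    ring
  -- From γ < 1 one gets nθ = n + 1 - 2γ > n - 1 ≥ 0.
  have hθ0 : (0 : ℝ) < θ := by
    have h1 : (γ : ℝ) < 1 := hγ₂.trans_lt (by rw [div_lt_one (by positivity)]; linarith)
    have h2 : 0 < (n : ℝ) * θ := by
      have : (1 : ℝ) ≤ n := by exact_mod_cast hn
      linarith
    exact pos_of_mul_pos_right h2 hn0.le
  obtain ⟨ι⟩ := exists_linearIsometry_euclideanSpace hm
  set ρ : EuclideanSpace ℝ (Fin (n + 1)) → EuclideanSpace ℝ (Fin m) :=
    fun x => ι (ballRetraction x) with hρ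
  have hρball : ∀ x, ρ x ∈ closedBall (0 : EuclideanSpace ℝ (Fin m)) 1 := fun x => by
    rw [mem_closedBall, dist_zero_right, ι.norm_map]
    exact norm_ballRetraction_le x
  have hρdist : ∀ x y, dist (ρ x) (ρ y) ≤ 2 * dist x y := fun x y => by
    rw [hρ, ι.dist_map]
    exact dist_ballRetraction_le x y
  have hρone : ∀ x, ‖x‖ ≤ 1 → ρ x = ι x := fun x hx => by
    rw [hρ]
    simp only [ballRetraction_of_le_one hx]
  have hmod : ∀ c : ℝ, 0 < c → ∃ C₁ C₂ t : ℝ, 0 ≤ C₁ ∧ 0 ≤ C₂ ∧ 0 < t ∧ C₁ ^ 2 * C₂ ^ n ≤ c ∧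
      ∀ r, r ≤ t → ∀ p q, dist p q ≤ r → dist (f (ρ p)) (f (ρ q)) ≤ C₁ * r ^ (γ : ℝ) ∧
        dist (f (ρ p)).toEuclidean (f (ρ q)).toEuclidean ≤ C₂ * r ^ (θ : ℝ) := by
    intro c hc
    -- The 2-Lipschitz map ρ multiplies C₁ by 2^γ and C₂ by 2^θ, hence the product by 2^(2γ + nθ) =
    -- 2^(n+1).
    obtain ⟨C₁, C₂, t, h1, h2, ht, h12, hest⟩ := exists_holder_moduli (Nat.ne_zero_of_lt hn) hf
      (div_pos hc (pow_pos two_pos (n + 1)))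
    have hpow : ((2 : ℝ) ^ (γ : ℝ)) ^ 2 * ((2 : ℝ) ^ (θ : ℝ)) ^ n = 2 ^ (n + 1) := by
      rw [← Real.rpow_natCast, ← Real.rpow_natCast, ← Real.rpow_natCast,
        ← Real.rpow_mul zero_le_two, ← Real.rpow_mul zero_le_two, ← Real.rpow_add two_pos]
      congr 1
      push_cast
      linarith
    refine ⟨C₁ * 2 ^ (γ : ℝ), C₂ * 2 ^ (θ : ℝ), t / 2, by positivity, by positivity,
      by positivity, ?_, fun r hr p q hpq => ?_⟩
    · rw [le_div_iff₀ (by positivity), ← hpow] at h12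
      refine le_trans (le_of_eq ?_) h12
      ring
    · have hr0 : 0 ≤ r := dist_nonneg.trans hpq
      have hd : dist (ρ p) (ρ q) ≤ 2 * r := (hρdist p q).trans (by linarith)
      obtain ⟨e1, e2⟩ := hest _ (hρball p) _ (hρball q) (hd.trans (by linarith))
      rw [mul_assoc, mul_assoc, ← Real.mul_rpow zero_le_two hr0, ← Real.mul_rpow zero_le_two hr0]
      exact ⟨e1.trans (by gcongr), e2.trans (by gcongr)⟩
  have hcont : Continuous fun z => (f (ρ z)).toEuclidean := by
    obtain ⟨C₁, C₂, t, -, -, ht, -, hest⟩ := hmod 1 one_pos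
    refine continuous_iff_continuousAt.2 fun x => tendsto_iff_dist_tendsto_zero.2 ?_
    have hlim : Tendsto (fun y => C₂ * dist y x ^ (θ : ℝ)) (nhds x) (nhds 0) := by
      have h : Tendsto (fun y => C₂ * dist y x ^ (θ : ℝ)) (nhds x)
          (nhds (C₂ * dist x x ^ (θ : ℝ))) :=
        (continuous_const.mul ((continuous_id.dist continuous_const).rpow_const
          fun _ => .inr hθ0.le)).tendsto x
      rwa [dist_self, Real.zero_rpow hθ0.ne', mul_zero] at h
    refine squeeze_zero' (Eventually.of_forall fun _ => dist_nonneg) ?_ hlim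
    filter_upwards [Metric.ball_mem_nhds x ht] with y hy
    exact (hest _ (le_of_lt hy) y x le_rfl).2
  -- A bound on the unit ball is global, since f ∘ ρ factors through the retraction.
  obtain ⟨R, -, hR⟩ := exists_bound_on_closedBall hcont 1
  refine HeisenbergSpace.not_injOn_sphere hθ0 hγθ hcont (R := R) (fun x hx => ?_) (fun x => ?_)
    hmod ?_
  · have h1 : ‖‖x‖⁻¹ • x‖ ≤ 1 := by
      rw [norm_smul, norm_inv, norm_norm, inv_mul_cancel₀ (by positivity)]
    simp only [hρ, ballRetraction_of_one_le hx, ballRetraction_of_le_one h1]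
  · have h := hR _ (norm_ballRetraction_le x)
    simpa only [hρ, ballRetraction_of_le_one (norm_ballRetraction_le x)] using h
  · intro x hx y hy hxy
    rw [mem_sphere_zero_iff_norm] at hx hy
    have h := Heisenberg.toEuclidean_injective hxy
    rw [hρone x hx.le, hρone y hy.le] at h
    have hmem : ∀ z : EuclideanSpace ℝ (Fin (n + 1)), ‖z‖ = 1 →
        ι z ∈ sphere (0 : EuclideanSpace ℝ (Fin m)) 1 := fun z hz => by
      rw [mem_sphere_zero_iff_norm, ι.norm_map, hz]
    have h' := @hemb.injective ⟨ι x, hmem x hx⟩ ⟨ι y, hmem y hy⟩ h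
    exact ι.injective (congrArg Subtype.val h')

end Nonembedding
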